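/- Fix $p\in\mathbb C$. Let $\mathcal D_{\mathbb A^1}=\mathbb C[z]\langle\tau,\tau^{-1}\rangle$ with $\tau z=(z-1)\tau$, and let $\mathcal D_{\mathbb A^{1*}}=R\langle\tau,\tau^{-1}\rangle$ with $R=\mathbb C\big[z,\tfrac1{z-p-i}: i\in\mathbb Z\big]$ (and $\tau f(z)=f(z-1)\tau$). A left module over one of these rings is called holonomic if it is finitely generated and each of its elements is annihilated by a nonzero operator; the categories of holonomic modules are denoted $\mathcal Hol(\mathcal D_{\mathbb A^1})$ and $\mathcal Hol(\mathcal D_{\mathbb A^{1*}})$. Put $\pi=z-p$. Let $\mathcal Hol(U_p)$ be the category of triples $(M^l,M,M^r)$, where $M$ is a finitely generated $\mathbb C[[\pi]]$-module and $M^l,M^r\subseteq M$ are $\mathbb C[[\pi]]$-submodules that are free of finite rank and such that $M/M^l$ and $M/M^r$ are finite dimensional torsion modules. Let $\mathcal Hol(U_p^*)$ be the category of triples $(M^l,M,M^r)$, where $M$ is a finite dimensional $\mathbb C((\pi))$-vector space and $M^l,M^r\subseteq M$ are $\mathbb C[[\pi]]$-submodules that are free of finite rank and such that $M/M^l$ and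 $M/M^r$ are torsion $\mathbb C[[\pi]]$-modules. In both categories the morphisms are the $\mathbb C[[\pi]]$-linear maps $\phi:M\to N$ with $\phi(M^l)\subseteq N^l$ and $\phi(M^r)\subseteq N^r$. There are the following restriction functors. - $\mathcal Hol(\mathcal D_{\mathbb A^1})\to\mathcal Hol(\mathcal D_{\mathbb A^{1*}})$ maps $M$ to $M|_{\mathbb A^{1*}}=R\otimes_{\mathbb C[z]}M$, with $\tau(f\otimes m)=f(z-1)\otimes\tau m$. - $\mathcal Hol(U_p)\to\mathcal Hol(U_p^*)$ maps $(M^l,M,M^r)$ to $\mathbb C((\pi))\otimes_{\mathbb C[[\pi]]}M$ together with the images of $M^l$ and $M^r$. - $\mathcal Hol(\mathcal D_{\mathbb A^1})\to\mathcal Hol(U_p)$ and $\mathcal Hol(\mathcal D_{\mathbb A^{1*}})\to\mathcal Hol(U_p^*)$ map $M$ to $\big((\tau^nL)_p,\,M_p,\,(\tau^{-n}L)_p\big)$. Here $N_p=\mathbb C[[z-p]]\otimes_{\mathbb C[z]}N$ for a $\mathbb C[z]$-module $N$ (for a $\mathcal D_{\mathbb A^{1*}}$-module $M$ this is $M_p=\mathbb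 C((z-p))\otimes_{\mathbb C[z]}M$), $L\subseteq M$ is any finitely generated $\mathbb C[z]$-submodule such that $M/L$ is torsion over $\mathbb C[z]$, and $n\gg0$; the result does not depend on $L$ and $n$. Theorem. The square formed by these four functors, which commutes up to the canonical natural isomorphism $\mathbb C((\pi))\otimes_{\mathbb C[[\pi]]}M_p\cong(M|_{\mathbb A^{1*}})_p$, is a fibre product of categories: the induced functor $$\mathcal Hol(\mathcal D_{\mathbb A^1})\longrightarrow \mathcal Hol(U_p)\times_{\mathcal Hol(U_p^*)}\mathcal Hol(\mathcal D_{\mathbb A^{1*}}),\qquad M\longmapsto\big(M|_{U_p},\,M|_{\mathbb A^{1*}},\,\cong\big),$$ to the category of triples $(M_{U_p},M_{\mathbb A^{1*}},\cong)$ consisting of an object of $\mathcal Hol(U_p)$, an object of $\mathcal Hol(\mathcal D_{\mathbb A^{1*}})$ and an isomorphism between their images in $\mathcal Hol(U_p^*)$, is an equivalence of categories. -/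

import Mathlib

set_option linter.unusedSectionVars false

open CategoryTheory CategoryTheory.Limits Filter
open scoped TensorProduct Polynomial

universe u

noncomputable section

namespace DifferenceModules

/-! ### The rings of difference operators -/

/-- The infinite cyclic group generated by the translation `τ`. -/
abbrev Translations : Type := Multiplicative ℤ

/-- The `n`-th power of the generator `τ`. -/
abbrev tpow (n : ℤ) : Translations := Multiplicative.ofAdd n

/-- Translations act on functions on the line by `(τ ^ n • f) (z) = f (z - n)`. -/
instance instPolynomialAction : MulSemiringAction Translations ℂ[X] where
  smul g f := f.comp (Polynomial.X - Polynomial.C ((Multiplicative.toAdd g : ℤ) : ℂ))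
  one_smul f := by
    change f.comp _ = f
    simp
  mul_smul g h f := by
    change f.comp _ = (f.comp _).comp _
    rw [Polynomial.comp_assoc]
    congr 1
    simp only [toAdd_mul, Int.cast_add, map_add, Polynomial.sub_comp, Polynomial.X_comp,
      Polynomial.C_comp]
    ring
  smul_zero g := Polynomial.zero_comp
  smul_add g f₁ f₂ := Polynomial.add_comp
  smul_one g := Polynomial.one_comp
  smul_mul g f₁ f₂ := Polynomial.mul_comp f₁ f₂ _

lemma tpow_smul (n : ℤ) (f : ℂ[X]) :
    tpow n • f = f.comp (Polynomial.X - Polynomial.C (n : ℂ)) := rfl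

lemma smul_eq_comp (g : Translations) (f : ℂ[X]) : g • f =
    f.comp (Polynomial.X - Polynomial.C ((Multiplicative.toAdd g : ℤ) : ℂ)) := rfl

/-- The multiplicative set generated by the functions `z - p - i`, for `i : ℤ`. -/
def orbitMonoid (p : ℂ) : Submonoid ℂ[X] :=
  Submonoid.closure (Set.range fun i : ℤ => Polynomial.X - Polynomial.C (p + (i : ℂ)))

/-- The ring of functions `ℂ[z, 1 / (z - p - i) : i ∈ ℤ]` on the punctured line
`𝔸¹ ∖ (p + ℤ)`. -/
abbrev PuncturedLine (p : ℂ) : Type := Localization (orbitMonoid p)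

lemma orbitMonoid_le_comap (p : ℂ) (g : Translations) : orbitMonoid p ≤
    (orbitMonoid p).comap (MulSemiringAction.toRingHom Translations ℂ[X] g) := by
  refine (Submonoid.closure_le).2 ?_
  rintro _ ⟨i, rfl⟩
  refine Submonoid.subset_closure ⟨i + Multiplicative.toAdd g, ?_⟩
  change _ = Polynomial.comp _ _
  simp only [Int.cast_add, map_add, Polynomial.sub_comp, Polynomial.X_comp, Polynomial.add_comp,
    Polynomial.C_comp]
  ring

/-- A translation, acting on the functions on the punctured line. -/
def puncturedShift (p : ℂ) (g : Translations) : PuncturedLine p →+* PuncturedLine p :=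
  IsLocalization.map (PuncturedLine p) (MulSemiringAction.toRingHom Translations ℂ[X] g)
    (orbitMonoid_le_comap p g)

lemma puncturedShift_algebraMap (p : ℂ) (g : Translations) (f : ℂ[X]) :
    puncturedShift p g (algebraMap ℂ[X] (PuncturedLine p) f) =
      algebraMap ℂ[X] (PuncturedLine p) (g • f) :=
  IsLocalization.map_eq (orbitMonoid_le_comap p g) f

/-- Translations act on the functions on the punctured line by the same formula. -/
instance instPuncturedAction (p : ℂ) : MulSemiringAction Translations (PuncturedLine p) where
  smul g a := puncturedShift p g a
  one_smul a := by
    change puncturedShift p 1 a = RingHom.id _ a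
    congr 1
    refine IsLocalization.ringHom_ext (orbitMonoid p) (RingHom.ext fun f => ?_)
    simp [puncturedShift_algebraMap]
  mul_smul g h a := by
    change puncturedShift p (g * h) a = ((puncturedShift p g).comp (puncturedShift p h)) a
    congr 1
    refine IsLocalization.ringHom_ext (orbitMonoid p) (RingHom.ext fun f => ?_)
    simp [puncturedShift_algebraMap, mul_smul]
  smul_zero g := map_zero (puncturedShift p g)
  smul_add g := map_add (puncturedShift p g)
  smul_one g := map_one (puncturedShift p g)
  smul_mul g := map_mul (puncturedShift p g)

lemma smul_algebraMap_punctured (p : ℂ) (g : Translations) (f : ℂ[X]) :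
    g • algebraMap ℂ[X] (PuncturedLine p) f = algebraMap ℂ[X] (PuncturedLine p) (g • f) :=
  puncturedShift_algebraMap p g f

/-- The ring `A⟨τ, τ⁻¹⟩` of difference operators with coefficients in `A`: finite sums
`∑ aₙ τⁿ`, with `τ a = (τ • a) τ`. For `A = ℂ[z]` this says `τ z = (z - 1) τ`. -/
abbrev DiffOp (A : Type) [CommRing A] [MulSemiringAction Translations A] : Type :=
  SkewMonoidAlgebra A Translations

/-- The operator `τ ^ n`. -/
def tau (A : Type) [CommRing A] [MulSemiringAction Translations A] (n : ℤ) : DiffOp A :=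
  SkewMonoidAlgebra.of A Translations (tpow n)

/-- Functions, as difference operators. -/
abbrev coeffHom (A : Type) [CommRing A] [MulSemiringAction Translations A] : A →+* DiffOp A :=
  SkewMonoidAlgebra.singleOneRingHom

section Operators

variable {A : Type} [CommRing A] [MulSemiringAction Translations A]

lemma tau_mul_coeff (n : ℤ) (a : A) :
    tau A n * coeffHom A a = coeffHom A (tpow n • a) * tau A n := by
  change SkewMonoidAlgebra.single _ _ * SkewMonoidAlgebra.single _ _ =
    SkewMonoidAlgebra.single _ _ * SkewMonoidAlgebra.single _ _
  simp [SkewMonoidAlgebra.single_mul_single]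

lemma tau_add (m n : ℤ) : tau A (m + n) = tau A m * tau A n := by
  rw [tau, tau, tau, ← map_mul]; rfl

lemma tau_zero : tau A 0 = 1 := map_one (SkewMonoidAlgebra.of A Translations)

end Operators

/-- A left module over the difference operators is holonomic if it is finitely generated and
each of its elements is annihilated by a nonzero operator. -/
def IsHolonomic (A : Type) [CommRing A] [MulSemiringAction Translations A] :
    ObjectProperty (ModuleCat.{u} (DiffOp A)) := fun M =>
  Module.Finite (DiffOp A) M ∧ ∀ m : M, ∃ d : DiffOp A, d ≠ 0 ∧ d • m = 0

/-- The category of holonomic difference modules. -/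
abbrev Hol (A : Type) [CommRing A] [MulSemiringAction Translations A] : Type (u + 1) :=
  (IsHolonomic.{u} A).FullSubcategory

/-! ### The underlying module over the functions -/

/-- The group underlying a difference module, regarded as a module over the functions. -/
def Und {A : Type} [CommRing A] [MulSemiringAction Translations A]
    (M : ModuleCat.{u} (DiffOp A)) : Type u := M

section Underlying

variable {A : Type} [CommRing A] [MulSemiringAction Translations A]
  (M : ModuleCat.{u} (DiffOp A))

instance : AddCommGroup (Und M) := inferInstanceAs (AddCommGroup M)

instance : Module (DiffOp A) (Und M) := inferInstanceAs (Module (DiffOp A) M)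

/-- The module structure on a difference module over the functions, or over any ring mapping
to the functions. -/
instance instModuleUnd {B : Type} [CommRing B] [Algebra B A] : Module B (Und M) :=
  Module.compHom (Und M) ((coeffHom A).comp (algebraMap B A))

variable {M}

lemma und_smul_def {B : Type} [CommRing B] [Algebra B A] (b : B) (v : Und M) :
    b • v = coeffHom A (algebraMap B A b) • v := rfl

instance {B : Type} [CommRing B] [Algebra B A] : IsScalarTower B A (Und M) where
  smul_assoc b a v := by
    simp only [und_smul_def, Algebra.smul_def, mul_smul, Algebra.algebraMap_self,
      RingHom.id_apply]

lemma tau_smul_smul (n : ℤ) (a : A) (v : Und M) :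
    tau A n • (a • v) = (tpow n • a) • (tau A n • v) := by
  simp only [und_smul_def, ← mul_smul, Algebra.algebraMap_self, RingHom.id_apply, tau_mul_coeff]

lemma tau_tau (m n : ℤ) (v : Und M) : tau A m • (tau A n • v) = tau A (m + n) • v := by
  rw [tau_add, mul_smul]

lemma tau_zero_smul (v : Und M) : tau A 0 • v = v := by rw [tau_zero, one_smul]

lemma smul_eq_sum (d : DiffOp A) (v : Und M) :
    d • v = ∑ g ∈ d.support, d.coeff g • (tau A (Multiplicative.toAdd g) • v) := by
  conv_lhs => rw [← SkewMonoidAlgebra.sum_single d, SkewMonoidAlgebra.sum_def, Finsupp.sum,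
    Finset.sum_smul]
  refine Finset.sum_congr rfl fun g _ => ?_
  rw [und_smul_def, ← mul_smul]
  congr 1
  change _ = SkewMonoidAlgebra.single _ _ * SkewMonoidAlgebra.single _ _
  simp [SkewMonoidAlgebra.single_mul_single, tpow]

end Underlying

/-! ### Formal disks -/

/-- The ring `ℂ⟦z - p⟧` of functions on the formal disk at `p`; the variable of the power series
is `π = z - p`. -/
def Disk (_p : ℂ) : Type := PowerSeries ℂ

/-- The field `ℂ⸨z - p⸩` of functions on the punctured formal disk at `p`. -/
def PuncturedDisk (_p : ℂ) : Type := LaurentSeries ℂ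

section Disks

variable (p : ℂ)

instance : CommRing (Disk p) := inferInstanceAs (CommRing (PowerSeries ℂ))
instance : IsDomain (Disk p) := inferInstanceAs (IsDomain (PowerSeries ℂ))
instance : IsPrincipalIdealRing (Disk p) :=
  inferInstanceAs (IsPrincipalIdealRing (PowerSeries ℂ))
instance : Field (PuncturedDisk p) := inferInstanceAs (Field (LaurentSeries ℂ))
instance : Algebra (Disk p) (PuncturedDisk p) :=
  inferInstanceAs (Algebra (PowerSeries ℂ) (LaurentSeries ℂ))
instance : IsFractionRing (Disk p) (PuncturedDisk p) :=
  inferInstanceAs (IsFractionRing (PowerSeries ℂ) (LaurentSeries ℂ))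

/-- Taylor expansion of polynomials at `p`, that is `z ↦ p + π`. -/
def expand : ℂ[X] →+* Disk p :=
  (Polynomial.coeToPowerSeries.ringHom (R := ℂ)).comp
    (Polynomial.taylorAlgHom p : ℂ[X] →ₐ[ℂ] ℂ[X]).toRingHom

instance : Algebra ℂ[X] (Disk p) := (expand p).toAlgebra
instance : Algebra ℂ[X] (PuncturedDisk p) :=
  ((algebraMap (Disk p) (PuncturedDisk p)).comp (expand p)).toAlgebra
instance : IsScalarTower ℂ[X] (Disk p) (PuncturedDisk p) :=
  IsScalarTower.of_algebraMap_eq fun _ => rfl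

lemma expand_eq (f : ℂ[X]) :
    algebraMap ℂ[X] (Disk p) f = ((Polynomial.taylor p f : ℂ[X]) : PowerSeries ℂ) := rfl

lemma expand_injective : Function.Injective (algebraMap ℂ[X] (Disk p)) := fun _ _ h =>
  Polynomial.taylor_injective p (Polynomial.coe_injective ℂ h)

lemma isUnit_expand {f : ℂ[X]} (hf : f.eval p ≠ 0) : IsUnit (algebraMap ℂ[X] (Disk p) f) := by
  rw [expand_eq]
  refine PowerSeries.isUnit_iff_constantCoeff.2 ?_
  rw [← PowerSeries.coeff_zero_eq_constantCoeff_apply, Polynomial.coeff_coe,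
    Polynomial.taylor_coeff_zero]
  exact hf.isUnit

lemma eventually_isUnit {f : ℂ[X]} (hf : f ≠ 0) :
    ∀ᶠ n : ℤ in cofinite, IsUnit (algebraMap ℂ[X] (Disk p) (tpow n • f)) := by
  have h : Set.Finite {n : ℤ | f.eval (p - n) = 0} := by
    refine Set.Finite.preimage (f := fun n : ℤ => p - (n : ℂ)) ?_
      (Polynomial.finite_setOfPred_isRoot hf)
    intro m _ n _ h
    simpa using h
  refine Filter.mem_of_superset h.compl_mem_cofinite fun n hn => isUnit_expand p ?_
  simpa [tpow_smul] using hn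

/-- The facts shared by the formal disk and the punctured formal disk at `p`. -/
class IsLocal (E : Type) [CommRing E] [Algebra ℂ[X] E] [Algebra (Disk p) E] : Prop where
  flat : Module.Flat ℂ[X] E
  injective : Function.Injective (algebraMap (Disk p) E)
  isDomain : IsDomain E
  denom : ∀ c : E, ∃ b : Disk p, b ≠ 0 ∧ ∃ a : Disk p, b • c = algebraMap (Disk p) E a

instance : IsLocal p (Disk p) where
  flat := by
    have : Module.IsTorsionFree ℂ[X] (Disk p) :=
      Module.isTorsionFree_iff_algebraMap_injective.2 (expand_injective p)
    infer_instance
  injective := Function.injective_id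
  isDomain := inferInstance
  denom c := ⟨1, one_ne_zero, c, one_smul _ _⟩

instance : IsLocal p (PuncturedDisk p) where
  flat := by
    have : Module.IsTorsionFree ℂ[X] (PuncturedDisk p) :=
      Module.isTorsionFree_iff_algebraMap_injective.2
        ((IsFractionRing.injective (Disk p) (PuncturedDisk p)).comp (expand_injective p))
    infer_instance
  injective := IsFractionRing.injective _ _
  isDomain := inferInstance
  denom c := by
    obtain ⟨⟨a, b⟩, h⟩ := IsLocalization.surj (nonZeroDivisors (Disk p)) c
    exact ⟨b, nonZeroDivisors.coe_ne_zero b, a, by rw [Algebra.smul_def, mul_comm]; exact h⟩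

end Disks

/-- The facts shared by the rings of functions on the line and on the punctured line. -/
class IsLine (A : Type) [CommRing A] [MulSemiringAction Translations A] [Algebra ℂ[X] A] :
    Prop where
  isDomain : IsDomain A
  injective : Function.Injective (algebraMap ℂ[X] A)
  smul_algebraMap : ∀ (g : Translations) (f : ℂ[X]),
    g • algebraMap ℂ[X] A f = algebraMap ℂ[X] A (g • f)
  denom : ∀ a : A, ∃ f : ℂ[X], f ≠ 0 ∧ ∃ h : ℂ[X], f • a = algebraMap ℂ[X] A h

instance : IsLine ℂ[X] where
  isDomain := inferInstance
  injective := Function.injective_id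
  smul_algebraMap _ _ := rfl
  denom a := ⟨1, one_ne_zero, a, one_smul _ _⟩

lemma orbitMonoid_le (p : ℂ) : orbitMonoid p ≤ nonZeroDivisors ℂ[X] := by
  refine (Submonoid.closure_le).2 ?_
  rintro _ ⟨i, rfl⟩
  exact mem_nonZeroDivisors_of_ne_zero (Polynomial.X_sub_C_ne_zero _)

instance (p : ℂ) : IsLine (PuncturedLine p) where
  isDomain := IsLocalization.isDomain_localization (orbitMonoid_le p)
  injective := IsLocalization.injective _ (orbitMonoid_le p)
  smul_algebraMap := smul_algebraMap_punctured p
  denom a := by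
    obtain ⟨⟨h, f⟩, e⟩ := IsLocalization.surj (orbitMonoid p) a
    exact ⟨f, nonZeroDivisors.ne_zero (orbitMonoid_le p f.2), h, by
      rw [Algebra.smul_def, mul_comm]; exact e⟩

/-! ### Coherent submodules -/

section Lattices

variable {A : Type} [CommRing A] [MulSemiringAction Translations A] [Algebra ℂ[X] A]
  (M : ModuleCat.{u} (DiffOp A))

/-- The set `𝓢(M)` of finitely generated `ℂ[z]`-submodules `L ⊆ M` with `M / L` torsion. -/
def coherentSubmodules : Set (Submodule ℂ[X] (Und M)) :=
  {L | L.FG ∧ Module.IsTorsion ℂ[X] (Und M ⧸ L)}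

variable {M}

lemma mem_coherent_iff {L : Submodule ℂ[X] (Und M)} : L ∈ coherentSubmodules M ↔
    L.FG ∧ ∀ v : Und M, ∃ f : ℂ[X], f ≠ 0 ∧ f • v ∈ L := by
  refine and_congr_right fun _ => ⟨fun h v => ?_, fun h x => ?_⟩
  · obtain ⟨f, hf⟩ := @h (Submodule.Quotient.mk v)
    refine ⟨f, nonZeroDivisors.coe_ne_zero f, ?_⟩
    rw [← Submodule.Quotient.mk_eq_zero]
    exact hf
  · obtain ⟨v, rfl⟩ := Submodule.Quotient.mk_surjective L x
    obtain ⟨f, hf, hv⟩ := h v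
    refine ⟨⟨f, mem_nonZeroDivisors_of_ne_zero hf⟩, ?_⟩
    exact (Submodule.Quotient.mk_eq_zero L).2 hv

lemma coherent_mono {L L' : Submodule ℂ[X] (Und M)} (hL : L ∈ coherentSubmodules M)
    (h : L ≤ L') (hL' : L'.FG) : L' ∈ coherentSubmodules M := by
  rw [mem_coherent_iff] at hL ⊢
  refine ⟨hL', fun v => ?_⟩
  obtain ⟨f, hf, hv⟩ := hL.2 v
  exact ⟨f, hf, h hv⟩

lemma coherent_denom {N L : Submodule ℂ[X] (Und M)} (hN : N.FG)
    (hL : ∀ v ∈ N, ∃ f : ℂ[X], f ≠ 0 ∧ f • v ∈ L) :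
    ∃ f : ℂ[X], f ≠ 0 ∧ ∀ v ∈ N, f • v ∈ L := by
  induction N, hN using Submodule.fg_induction with
  | singleton v =>
    obtain ⟨f, hf, hv⟩ := hL v (Submodule.mem_span_singleton_self v)
    refine ⟨f, hf, fun w hw => ?_⟩
    obtain ⟨g, rfl⟩ := Submodule.mem_span_singleton.1 hw
    rw [smul_comm]
    exact L.smul_mem _ hv
  | sup N₁ N₂ _ _ h₁ h₂ =>
    obtain ⟨f, hf, h₁⟩ := h₁ fun v hv => hL v (Submodule.mem_sup_left hv)
    obtain ⟨g, hg, h₂⟩ := h₂ fun v hv => hL v (Submodule.mem_sup_right hv)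
    refine ⟨f * g, mul_ne_zero hf hg, fun v hv => ?_⟩
    obtain ⟨x, hx, y, hy, rfl⟩ := Submodule.mem_sup.1 hv
    rw [smul_add]
    refine L.add_mem ?_ ?_
    · rw [mul_comm, mul_smul]; exact L.smul_mem _ (h₁ _ hx)
    · rw [mul_smul]; exact L.smul_mem _ (h₂ _ hy)

variable [IsLine A]

lemma tau_smul_poly (n : ℤ) (f : ℂ[X]) (v : Und M) :
    tau A n • (f • v) = (tpow n • f) • (tau A n • v) := by
  rw [← algebraMap_smul A f v, tau_smul_smul, IsLine.smul_algebraMap, algebraMap_smul]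

/-- The submodule `τⁿ L`. -/
def translate (n : ℤ) (L : Submodule ℂ[X] (Und M)) : Submodule ℂ[X] (Und M) where
  carrier := (fun v => tau A n • v) '' (L : Set (Und M))
  zero_mem' := ⟨0, L.zero_mem, smul_zero _⟩
  add_mem' := by
    rintro _ _ ⟨v, hv, rfl⟩ ⟨w, hw, rfl⟩
    exact ⟨v + w, L.add_mem hv hw, smul_add _ _ _⟩
  smul_mem' := by
    rintro f _ ⟨v, hv, rfl⟩
    refine ⟨(tpow (-n) • f) • v, L.smul_mem _ hv, ?_⟩
    change tau A n • ((tpow (-n) • f) • v) = f • (tau A n • v)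
    rw [tau_smul_poly, ← mul_smul]
    simp [tpow]

lemma mem_translate {n : ℤ} {L : Submodule ℂ[X] (Und M)} {v : Und M} :
    v ∈ translate n L ↔ ∃ w ∈ L, tau A n • w = v := Iff.rfl

lemma translate_fg (n : ℤ) {L : Submodule ℂ[X] (Und M)} (hL : L.FG) :
    (translate n L).FG := by
  classical
  obtain ⟨S, rfl⟩ := hL
  refine ⟨S.image fun v => tau A n • v, le_antisymm (Submodule.span_le.2 ?_) ?_⟩
  · intro v hv
    obtain ⟨w, hw, rfl⟩ := Finset.mem_image.1 (Finset.mem_coe.1 hv)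
    exact ⟨w, Submodule.subset_span hw, rfl⟩
  · rintro _ ⟨v, hv, rfl⟩
    refine Submodule.span_induction (fun w hw => ?_) ?_ (fun x y _ _ hx hy => ?_)
      (fun f x _ hx => ?_) hv
    · exact Submodule.subset_span (Finset.mem_coe.2 (Finset.mem_image_of_mem _ hw))
    · simp
    · simp only [smul_add]; exact Submodule.add_mem _ hx hy
    · simp only [tau_smul_poly]; exact Submodule.smul_mem _ _ hx

lemma translate_translate (m n : ℤ) (L : Submodule ℂ[X] (Und M)) :
    translate m (translate n L) = translate (m + n) L := by
  ext v
  simp only [mem_translate]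
  constructor
  · rintro ⟨_, ⟨w, hw, rfl⟩, rfl⟩
    exact ⟨w, hw, (tau_tau _ _ _).symm⟩
  · rintro ⟨w, hw, rfl⟩
    exact ⟨_, ⟨w, hw, rfl⟩, tau_tau _ _ _⟩

end Lattices

section Existence

variable {A : Type} [CommRing A] [MulSemiringAction Translations A] [Algebra ℂ[X] A] [IsLine A]
  {M : ModuleCat.{u} (DiffOp A)}

/-- The elements that are torsion modulo `L`. -/
def saturation (L : Submodule ℂ[X] (Und M)) : Submodule A (Und M) where
  carrier := {v | ∃ f : ℂ[X], f ≠ 0 ∧ f • v ∈ L}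
  zero_mem' := ⟨1, one_ne_zero, by simp⟩
  add_mem' := by
    rintro v w ⟨f, hf, hv⟩ ⟨g, hg, hw⟩
    refine ⟨f * g, mul_ne_zero hf hg, ?_⟩
    rw [smul_add]
    refine L.add_mem ?_ ?_
    · rw [mul_comm, mul_smul]; exact L.smul_mem _ hv
    · rw [mul_smul]; exact L.smul_mem _ hw
  smul_mem' := by
    rintro a v ⟨f, hf, hv⟩
    obtain ⟨g, hg, h, e⟩ := IsLine.denom a
    refine ⟨f * g, mul_ne_zero hf hg, ?_⟩
    rw [mul_smul, ← smul_assoc g a v, e, algebraMap_smul, smul_comm]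
    exact L.smul_mem _ hv

lemma mem_saturation_of_smul {L : Submodule ℂ[X] (Und M)} {a : A} (ha : a ≠ 0) {v : Und M}
    (h : a • v ∈ saturation L) : v ∈ saturation L := by
  have := IsLine.isDomain (A := A)
  obtain ⟨f, hf, h⟩ := h
  obtain ⟨g, hg, k, e⟩ := IsLine.denom a
  refine ⟨f * k, mul_ne_zero hf ?_, ?_⟩
  · rintro rfl
    rw [map_zero, Algebra.smul_def, mul_eq_zero] at e
    exact e.elim (fun e => hg (IsLine.injective (e.trans (map_zero _).symm))) ha
  · have : (f * k) • v = g • (f • (a • v)) := by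
      rw [smul_comm g f, ← smul_assoc g a v, e, algebraMap_smul, mul_smul]
    rw [this]
    exact L.smul_mem _ h

lemma saturation_mono {L L' : Submodule ℂ[X] (Und M)} (h : L ≤ L') :
    saturation L ≤ saturation L' := by
  rintro v ⟨f, hf, hv⟩
  exact ⟨f, hf, h hv⟩

lemma le_saturation {L : Submodule ℂ[X] (Und M)} {v : Und M} (h : v ∈ L) : v ∈ saturation L :=
  ⟨1, one_ne_zero, by simpa using h⟩

lemma tau_smul_sum (n : ℤ) (d : DiffOp A) (v : Und M) : tau A n • (d • v) =
    ∑ g ∈ d.support, (tpow n • d.coeff g) • (tau A (n + Multiplicative.toAdd g) • v) := by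
  rw [smul_eq_sum d v, Finset.smul_sum]
  refine Finset.sum_congr rfl fun g _ => ?_
  rw [tau_smul_smul, tau_tau]

/-- One term of a linear relation is in a submodule as soon as all the others are. -/
lemma mem_of_relation {L : Submodule ℂ[X] (Und M)} {d : DiffOp A} {v : Und M} (h : d • v = 0)
    (n : ℤ) {g : Translations} (hg : g ∈ d.support)
    (H : ∀ k ∈ d.support, k ≠ g → tau A (n + Multiplicative.toAdd k) • v ∈ saturation L) :
    tau A (n + Multiplicative.toAdd g) • v ∈ saturation L := by
  classical
  have h0 := tau_smul_sum n d v
  rw [h, smul_zero, ← Finset.add_sum_erase _ _ hg, eq_comm, add_eq_zero_iff_eq_neg] at h0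
  have hne : tpow n • d.coeff g ≠ 0 :=
    (smul_ne_zero_iff_ne (tpow n)).2 (SkewMonoidAlgebra.mem_support_iff.1 hg)
  refine mem_saturation_of_smul hne ?_
  rw [h0]
  refine Submodule.neg_mem _ (Submodule.sum_mem _ fun k hk => Submodule.smul_mem _ _ ?_)
  exact H k (Finset.mem_of_mem_erase hk) (Finset.ne_of_mem_erase hk)

lemma exists_saturation (v : Und M) (hv : ∃ d : DiffOp A, d ≠ 0 ∧ d • v = 0) :
    ∃ L : Submodule ℂ[X] (Und M), L.FG ∧ ∀ n : ℤ, tau A n • v ∈ saturation L := by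
  classical
  obtain ⟨d, hd, h⟩ := hv
  have hs : (d.support.image Multiplicative.toAdd).Nonempty := by
    rw [Finset.image_nonempty, Finset.nonempty_iff_ne_empty]
    exact fun e => hd (SkewMonoidAlgebra.support_eq_empty.1 e)
  obtain ⟨a, ha, ha'⟩ : ∃ a : Translations, a ∈ d.support ∧
      ∀ k ∈ d.support, Multiplicative.toAdd a ≤ Multiplicative.toAdd k := by
    obtain ⟨a, ha, e⟩ := Finset.mem_image.1 (Finset.min'_mem _ hs)
    exact ⟨a, ha, fun k hk => e ▸ Finset.min'_le _ _ (Finset.mem_image_of_mem _ hk)⟩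
  obtain ⟨b, hb, hb'⟩ : ∃ b : Translations, b ∈ d.support ∧
      ∀ k ∈ d.support, Multiplicative.toAdd k ≤ Multiplicative.toAdd b := by
    obtain ⟨a, ha, e⟩ := Finset.mem_image.1 (Finset.max'_mem _ hs)
    exact ⟨a, ha, fun k hk => e ▸ Finset.le_max' _ _ (Finset.mem_image_of_mem _ hk)⟩
  let I : Finset ℤ := Finset.Icc (Multiplicative.toAdd a) (Multiplicative.toAdd b)
  let L : Submodule ℂ[X] (Und M) := Submodule.span ℂ[X] (I.image fun n => tau A n • v)
  have hI : ∀ n : ℤ, ∀ i ∈ I, tau A (n + i) • v ∈ saturation L := by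
    intro n
    induction n using Int.induction_on with
    | zero =>
      intro i hi
      rw [zero_add]
      exact le_saturation (Submodule.subset_span
        (Finset.mem_coe.2 (Finset.mem_image_of_mem (fun n => tau A n • v) hi)))
    | succ n ih =>
      intro i hi
      obtain ⟨h1, h2⟩ := Finset.mem_Icc.1 hi
      rcases h2.lt_or_eq with h2 | h2
      · rw [show (n : ℤ) + 1 + i = n + (i + 1) by ring]
        exact ih _ (Finset.mem_Icc.2 ⟨by omega, by omega⟩)
      · rw [h2]
        refine mem_of_relation h _ hb fun k hk hkb => ?_
        have h3 := hb' k hk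
        have h4 := ha' k hk
        have h5 : Multiplicative.toAdd k ≠ Multiplicative.toAdd b := fun e =>
          hkb (Multiplicative.toAdd.injective e)
        rw [show (n : ℤ) + 1 + Multiplicative.toAdd k = n + (Multiplicative.toAdd k + 1) by ring]
        exact ih _ (Finset.mem_Icc.2 ⟨by omega, by omega⟩)
    | pred n ih =>
      intro i hi
      obtain ⟨h1, h2⟩ := Finset.mem_Icc.1 hi
      rcases h1.lt_or_eq with h1 | h1
      · rw [show -(n : ℤ) - 1 + i = -n + (i - 1) by ring]
        exact ih _ (Finset.mem_Icc.2 ⟨by omega, by omega⟩)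
      · rw [← h1]
        refine mem_of_relation h _ ha fun k hk hka => ?_
        have h3 := hb' k hk
        have h4 := ha' k hk
        have h5 : Multiplicative.toAdd k ≠ Multiplicative.toAdd a := fun e =>
          hka (Multiplicative.toAdd.injective e)
        rw [show -(n : ℤ) - 1 + Multiplicative.toAdd k = -n + (Multiplicative.toAdd k - 1) by ring]
        exact ih _ (Finset.mem_Icc.2 ⟨by omega, by omega⟩)
  refine ⟨L, ⟨_, rfl⟩, fun n => ?_⟩
  have := hI (n - Multiplicative.toAdd a) (Multiplicative.toAdd a)
    (Finset.mem_Icc.2 ⟨le_rfl, ha' b hb⟩)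
  simpa using this

/-- A holonomic difference module contains finitely generated submodules over `ℂ[z]` with torsion
quotient; they may be taken to contain a generating set. -/
lemma exists_coherent (hM : IsHolonomic A M) : ∃ L ∈ coherentSubmodules M,
    ∃ S : Set (Und M), S ⊆ L ∧ Submodule.span (DiffOp A) S = ⊤ := by
  classical
  obtain ⟨⟨hS⟩, hM⟩ := hM
  obtain ⟨S, hS⟩ : ∃ S : Finset (Und M), Submodule.span (DiffOp A) (S : Set (Und M)) = ⊤ := hS
  choose N hN hN' using fun v : Und M => exists_saturation v (hM v)
  let L : Submodule ℂ[X] (Und M) := Submodule.span ℂ[X] S ⊔ S.sup N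
  have hL : L.FG := Submodule.FG.sup ⟨S, rfl⟩ (Submodule.fg_finset_sup S N fun i _ => hN i)
  refine ⟨L, mem_coherent_iff.2 ⟨hL, fun v => ?_⟩, (S : Set (Und M)),
    (Submodule.subset_span).trans (le_sup_left (a := Submodule.span ℂ[X] (S : Set (Und M)))), hS⟩
  have hv : v ∈ Submodule.span (DiffOp A) (S : Set (Und M)) := by rw [hS]; trivial
  suffices h : v ∈ saturation L by exact h
  induction hv using Submodule.closure_induction with
  | zero => exact zero_mem _
  | add x y _ _ hx hy => exact add_mem hx hy
  | smul_mem d x hx =>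
    rw [smul_eq_sum]
    refine Submodule.sum_mem _ fun g _ => Submodule.smul_mem _ _ ?_
    exact saturation_mono ((Finset.le_sup (Finset.mem_coe.1 hx)).trans le_sup_right) (hN' x _)

end Existence

/-! ### Restriction to the formal disks: lattices -/

/-- A submodule `N` of `V` is free of finite rank, with torsion quotient `V / N`. -/
structure IsFreeCotorsion {O : Type} [CommRing O] {V : Type u} [AddCommGroup V] [Module O V]
    (N : Submodule O V) : Prop where
  finite : Module.Finite O N
  free : Module.Free O N
  torsion : Module.IsTorsion O (V ⧸ N)

section Ends

variable (p : ℂ) {A : Type} [CommRing A] [MulSemiringAction Translations A] [Algebra ℂ[X] A]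
  (E : Type) [CommRing E] [Algebra ℂ[X] E] [Algebra (Disk p) E] [IsScalarTower ℂ[X] (Disk p) E]

/-- For a submodule `L` of a difference module `M`, the formal fibre `L_p`, as a submodule of the
formal fibre `E ⊗ M`; by flatness it is isomorphic to `ℂ⟦z - p⟧ ⊗ L`. -/
def formalFibre {M : ModuleCat.{u} (DiffOp A)} (L : Submodule ℂ[X] (Und M)) :
    Submodule (Disk p) (E ⊗[ℂ[X]] Und M) :=
  Submodule.span (Disk p) ((fun v => (1 : E) ⊗ₜ[ℂ[X]] v) '' (L : Set (Und M)))

variable [IsLine A]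

/-- The common value of `(τⁿ L)_p`, for all `L ∈ 𝓢(M)` and for all `n` near the end `l` of `ℤ`
(the supremum is over a set with exactly one element if `M` is holonomic and `l` is
`atTop` or `atBot`). -/
def endLattice (l : Filter ℤ) (M : ModuleCat.{u} (DiffOp A)) :
    Submodule (Disk p) (E ⊗[ℂ[X]] Und M) :=
  sSup {N | ∃ L ∈ coherentSubmodules M, ∀ᶠ n in l, formalFibre p E (translate n L) = N}

variable {p E} {M : ModuleCat.{u} (DiffOp A)}

lemma formalFibre_le {N L : Submodule ℂ[X] (Und M)} {f : ℂ[X]}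
    (hf : IsUnit (algebraMap ℂ[X] (Disk p) f)) (h : ∀ v ∈ N, f • v ∈ L) :
    formalFibre p E N ≤ formalFibre p E L := by
  refine Submodule.span_le.2 ?_
  rintro _ ⟨v, hv, rfl⟩
  have h1 : (1 : E) ⊗ₜ[ℂ[X]] (f • v) ∈ formalFibre p E L := Submodule.subset_span ⟨_, h v hv, rfl⟩
  rw [TensorProduct.tmul_smul, ← algebraMap_smul (Disk p) f] at h1
  exact (Submodule.smul_mem_iff_of_isUnit _ hf).1 h1

lemma smul_mem_translate {N L : Submodule ℂ[X] (Und M)} {f : ℂ[X]} (h : ∀ v ∈ N, f • v ∈ L)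
    (n : ℤ) : ∀ v ∈ translate n N, (tpow n • f) • v ∈ translate n L := by
  rintro _ ⟨v, hv, rfl⟩
  exact ⟨_, h v hv, tau_smul_poly n f v⟩

lemma eventually_formalFibre_le {N L : Submodule ℂ[X] (Und M)} (hN : N.FG)
    (hL : L ∈ coherentSubmodules M) :
    ∀ᶠ n : ℤ in cofinite, formalFibre p E (translate n N) ≤ formalFibre p E (translate n L) := by
  obtain ⟨f, hf, h⟩ := coherent_denom hN fun v _ => (mem_coherent_iff.1 hL).2 v
  filter_upwards [eventually_isUnit p hf] with n hn
  exact formalFibre_le hn (smul_mem_translate h n)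

lemma translate_mem_coherent (n : ℤ) {L : Submodule ℂ[X] (Und M)}
    (hL : L ∈ coherentSubmodules M) : translate n L ∈ coherentSubmodules M := by
  rw [mem_coherent_iff] at hL ⊢
  refine ⟨translate_fg n hL.1, fun v => ?_⟩
  obtain ⟨f, hf, hv⟩ := hL.2 (tau A (-n) • v)
  refine ⟨tpow n • f, (smul_ne_zero_iff_ne _).2 hf, _, hv, ?_⟩
  change tau A n • (f • (tau A (-n) • v)) = _
  rw [tau_smul_poly, tau_tau, add_neg_cancel, tau_zero_smul]

lemma eventually_formalFibre_eq {L L' : Submodule ℂ[X] (Und M)}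
    (hL : L ∈ coherentSubmodules M) (hL' : L' ∈ coherentSubmodules M) :
    ∀ᶠ n : ℤ in cofinite, formalFibre p E (translate n L) = formalFibre p E (translate n L') := by
  filter_upwards [eventually_formalFibre_le (p := p) (E := E) hL.1 hL',
    eventually_formalFibre_le (p := p) (E := E) hL'.1 hL] with n h h'
  exact le_antisymm h h'

lemma eventually_formalFibre_succ {L : Submodule ℂ[X] (Und M)} (hL : L ∈ coherentSubmodules M) :
    ∀ᶠ n : ℤ in cofinite,
      formalFibre p E (translate (n + 1) L) = formalFibre p E (translate n L) := by
  filter_upwards [eventually_formalFibre_eq (p := p) (E := E) (translate_mem_coherent 1 hL) hL]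
    with n h
  rw [← h, translate_translate]

/-- The two ends of `ℤ`. -/
def IsEnd (l : Filter ℤ) : Prop := l = atTop ∨ l = atBot

lemma IsEnd.neBot {l : Filter ℤ} (hl : IsEnd l) : l.NeBot := by
  rcases hl with rfl | rfl <;> infer_instance

lemma IsEnd.le {l : Filter ℤ} (hl : IsEnd l) : l ≤ cofinite := by
  rcases hl with rfl | rfl
  · exact atTop_le_cofinite
  · exact atBot_le_cofinite

lemma exists_eventually_eq {α : Type*} {l : Filter ℤ} (hl : IsEnd l) {s : ℤ → α}
    (h : ∀ᶠ n : ℤ in cofinite, s (n + 1) = s n) : ∃ a, ∀ᶠ n in l, s n = a := by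
  have h := hl.le h
  rcases hl with rfl | rfl
  · obtain ⟨n₀, h⟩ := eventually_atTop.1 h
    refine ⟨s n₀, eventually_atTop.2 ⟨n₀, fun n hn => ?_⟩⟩
    induction n, hn using Int.leInduction with
    | base => rfl
    | succ n hn ih => rw [h n hn, ih]
  · obtain ⟨n₀, h⟩ := eventually_atBot.1 h
    refine ⟨s n₀, eventually_atBot.2 ⟨n₀, fun n hn => ?_⟩⟩
    induction n, hn using Int.leInductionDown with
    | base => rfl
    | pred n hn ih =>
      rw [← ih, ← h (n - 1) (by omega), sub_add_cancel]

/-- The lattices at the ends are well defined: `(τⁿ L)_p` does not depend on `L ∈ 𝓢(M)` nor on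
`n` near the end. -/
theorem endLattice_eq {l : Filter ℤ} (hl : IsEnd l) {L : Submodule ℂ[X] (Und M)}
    (hL : L ∈ coherentSubmodules M) :
    ∀ᶠ n in l, formalFibre p E (translate n L) = endLattice p E l M := by
  have := hl.neBot
  obtain ⟨N, hN⟩ := exists_eventually_eq hl (s := fun n => formalFibre p E (translate n L))
    (eventually_formalFibre_succ hL)
  have : endLattice p E l M = N := by
    refine le_antisymm (sSup_le ?_) (le_sSup ⟨L, hL, hN⟩)
    rintro N' ⟨L', hL', hN'⟩
    obtain ⟨n, h1, h2, h3⟩ :=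
      (hN.and (hN'.and (hl.le (eventually_formalFibre_eq (p := p) (E := E) hL hL')))).exists
    rw [← h1, ← h2, h3]
  rwa [this]

lemma formalFibre_fg {L : Submodule ℂ[X] (Und M)} (hL : L.FG) : (formalFibre p E L).FG := by
  classical
  obtain ⟨S, rfl⟩ := hL
  refine ⟨S.image fun v => (1 : E) ⊗ₜ[ℂ[X]] v, le_antisymm (Submodule.span_mono ?_)
    (Submodule.span_le.2 ?_)⟩
  · intro x hx
    obtain ⟨v, hv, rfl⟩ := Finset.mem_image.1 (Finset.mem_coe.1 hx)
    exact ⟨v, Submodule.subset_span hv, rfl⟩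
  · rintro _ ⟨v, hv, rfl⟩
    refine Submodule.span_induction (fun w hw => ?_) ?_ (fun x y _ _ hx hy => ?_)
      (fun f x _ hx => ?_) hv
    · exact Submodule.subset_span (Finset.mem_coe.2 (Finset.mem_image_of_mem _ hw))
    · simp
    · simp only [TensorProduct.tmul_add]; exact Submodule.add_mem _ hx hy
    · simp only [TensorProduct.tmul_smul, ← algebraMap_smul (Disk p) f]
      exact Submodule.smul_mem _ _ hx

lemma formalFibre_torsionFree [IsLocal p E] {L : Submodule ℂ[X] (Und M)}
    (hL : ∀ v ∈ L, ∀ f : ℂ[X], f ≠ 0 → f • v = 0 → v = 0) {x : E ⊗[ℂ[X]] Und M}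
    (hx : x ∈ formalFibre p E L) {a : Disk p} (ha : a ≠ 0) (h : a • x = 0) : x = 0 := by
  have hflat := IsLocal.flat p (E := E)
  have hdom := IsLocal.isDomain p (E := E)
  have htf : Module.IsTorsionFree ℂ[X] L := by
    refine Module.IsTorsionFree.of_smul_eq_zero fun f v h => ?_
    by_contra! H
    exact H.2 (Subtype.ext (hL v v.2 f H.1 (congrArg Subtype.val h)))
  have : Module.Flat ℂ[X] L := inferInstance
  have hinj : Function.Injective
      (TensorProduct.AlgebraTensorModule.lTensor (Disk p) E L.subtype) :=
    Module.Flat.lTensor_preserves_injective_linearMap (M := E) L.subtype L.subtype_injective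
  have hle : formalFibre p E L ≤
      LinearMap.range (TensorProduct.AlgebraTensorModule.lTensor (Disk p) E L.subtype) := by
    refine Submodule.span_le.2 ?_
    rintro _ ⟨v, hv, rfl⟩
    exact ⟨1 ⊗ₜ ⟨v, hv⟩, rfl⟩
  obtain ⟨y, rfl⟩ := hle hx
  rw [← map_smul, map_eq_zero_iff _ hinj] at h
  have h' : algebraMap (Disk p) E a • y = 0 := by rw [algebraMap_smul]; exact h
  have hne : algebraMap (Disk p) E a ≠ 0 := fun e =>
    ha (IsLocal.injective (p := p) (E := E) (e.trans (map_zero _).symm))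
  have : y = 0 := (smul_eq_zero.1 h').resolve_left hne
  rw [this, map_zero]

lemma exists_torsionFree_coherent {L : Submodule ℂ[X] (Und M)} (hL : L ∈ coherentSubmodules M) :
    ∃ L' ∈ coherentSubmodules M, ∀ v ∈ L', ∀ f : ℂ[X], f ≠ 0 → f • v = 0 → v = 0 := by
  rw [mem_coherent_iff] at hL
  have : IsNoetherian ℂ[X] L := isNoetherian_of_fg_of_noetherian L hL.1
  have hN : (L ⊓ Submodule.torsion ℂ[X] (Und M)).FG := by
    rw [← Submodule.map_comap_subtype]
    exact (IsNoetherian.noetherian _).map _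
  obtain ⟨g, hg, h⟩ := coherent_denom (L := ⊥) hN fun v hv => by
    obtain ⟨f, hf⟩ := (Submodule.mem_torsion_iff v).1 hv.2
    exact ⟨f, nonZeroDivisors.coe_ne_zero f, hf⟩
  refine ⟨L.map (LinearMap.lsmul ℂ[X] (Und M) g), mem_coherent_iff.2 ⟨hL.1.map _, fun v => ?_⟩, ?_⟩
  · obtain ⟨f, hf, hv⟩ := hL.2 v
    exact ⟨g * f, mul_ne_zero hg hf, f • v, hv, (mul_smul g f v).symm⟩
  · rintro _ ⟨w, hw, rfl⟩ f hf hfw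
    refine (Submodule.mem_bot ℂ[X]).1 (h w ⟨hw, (Submodule.mem_torsion_iff w).2 ?_⟩)
    exact ⟨⟨f * g, mem_nonZeroDivisors_of_ne_zero (mul_ne_zero hf hg)⟩,
      (mul_smul f g w).trans hfw⟩

/-- The lattices at the ends of a holonomic difference module are free of finite rank, and the
quotients by them are torsion. -/
lemma endLattice_spec [IsLocal p E] (hM : IsHolonomic A M) {l : Filter ℤ} (hl : IsEnd l) :
    IsFreeCotorsion (endLattice p E l M) := by
  have := hl.neBot
  obtain ⟨L₀, hL₀, -⟩ := exists_coherent hM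
  obtain ⟨L, hL, htf⟩ := exists_torsionFree_coherent hL₀
  obtain ⟨n, hn⟩ := (endLattice_eq (p := p) (E := E) hl hL).exists
  have hLn := translate_mem_coherent n hL
  have htf' : ∀ v ∈ translate n L, ∀ f : ℂ[X], f ≠ 0 → f • v = 0 → v = 0 := by
    rintro _ ⟨w, hw, rfl⟩ f hf h
    change f • (tau A n • w) = 0 at h
    have h1 : (tpow (-n) • f) • w = 0 := by
      have h2 := tau_smul_poly (-n) f (tau A n • w)
      rwa [h, smul_zero, tau_tau, neg_add_cancel, tau_zero_smul, eq_comm] at h2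
    change tau A n • w = 0
    rw [htf w hw _ ((smul_ne_zero_iff_ne _).2 hf) h1, smul_zero]
  rw [← hn]
  have hfin : Module.Finite (Disk p) (formalFibre p E (translate n L)) :=
    Module.Finite.iff_fg.2 (formalFibre_fg hLn.1)
  have htor : Module.IsTorsionFree (Disk p) (formalFibre p E (translate n L)) := by
    refine Module.IsTorsionFree.of_smul_eq_zero (R := Disk p)
      (M := formalFibre p E (translate n L)) fun a x h => ?_
    by_contra! H
    exact H.2 (Subtype.ext (formalFibre_torsionFree htf' x.2 H.1 (congrArg Subtype.val h)))
  have hfree : Module.Free (Disk p) (formalFibre p E (translate n L)) :=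
    Module.free_of_finite_type_torsion_free' (R := Disk p)
      (M := formalFibre p E (translate n L))
  refine ⟨hfin, hfree, fun x => ?_⟩
  obtain ⟨x, rfl⟩ := Submodule.Quotient.mk_surjective _ x
  suffices h : ∃ a : Disk p, a ≠ 0 ∧ a • x ∈ formalFibre p E (translate n L) by
    obtain ⟨a, ha, h⟩ := h
    exact ⟨⟨a, mem_nonZeroDivisors_of_ne_zero ha⟩, (Submodule.Quotient.mk_eq_zero _).2 h⟩
  induction x using TensorProduct.induction_on with
  | zero => exact ⟨1, one_ne_zero, by simp⟩
  | tmul c v =>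
    obtain ⟨f, hf, hv⟩ := (mem_coherent_iff.1 hLn).2 v
    obtain ⟨b, hb, a, e⟩ := IsLocal.denom (p := p) c
    refine ⟨algebraMap ℂ[X] (Disk p) f * b, mul_ne_zero ?_ hb, ?_⟩
    · exact fun e => hf (expand_injective p (e.trans (map_zero _).symm))
    · have : (algebraMap ℂ[X] (Disk p) f * b) • (c ⊗ₜ[ℂ[X]] v) = a • ((1 : E) ⊗ₜ[ℂ[X]] (f • v)) := by
        rw [mul_smul, TensorProduct.smul_tmul', e, algebraMap_smul, TensorProduct.tmul_smul,
          smul_comm a f, TensorProduct.smul_tmul' a, Algebra.algebraMap_eq_smul_one]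
      rw [this]
      exact Submodule.smul_mem _ _ (Submodule.subset_span ⟨_, hv, rfl⟩)
  | add x y hx hy =>
    obtain ⟨a, ha, hx⟩ := hx
    obtain ⟨b, hb, hy⟩ := hy
    refine ⟨a * b, mul_ne_zero ha hb, ?_⟩
    rw [smul_add]
    refine Submodule.add_mem _ ?_ ?_
    · rw [mul_comm, mul_smul]; exact Submodule.smul_mem _ _ hx
    · rw [mul_smul]; exact Submodule.smul_mem _ _ hy

/-- The formal fibre of a holonomic difference module on the line is finitely generated. -/
lemma finite_fibre_line {M : ModuleCat.{u} (DiffOp ℂ[X])} (hM : IsHolonomic ℂ[X] M) :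
    Module.Finite (Disk p) (Disk p ⊗[ℂ[X]] Und M) := by
  obtain ⟨L, hL, S, hSL, hS⟩ := exists_coherent hM
  have h1 := endLattice_eq (p := p) (E := Disk p) (l := atTop) (Or.inl rfl) hL
  have h2 := endLattice_eq (p := p) (E := Disk p) (l := atBot) (Or.inr rfl) hL
  obtain ⟨b, hb⟩ := eventually_atTop.1 h1
  obtain ⟨a, ha⟩ := eventually_atBot.1 h2
  let W : Submodule (Disk p) (Disk p ⊗[ℂ[X]] Und M) :=
    (Finset.Icc (min a b) (max a b)).sup fun n => formalFibre p (Disk p) (translate n L)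
  have hW : W.FG := Submodule.fg_finset_sup _ _ fun n _ => formalFibre_fg (translate_fg n hL.1)
  have hmem : ∀ n, formalFibre p (Disk p) (translate n L) ≤ W := by
    intro n
    have key : ∀ m, m ∈ Finset.Icc (min a b) (max a b) →
        formalFibre p (Disk p) (translate m L) ≤ W := fun m hm =>
      Finset.le_sup (f := fun n => formalFibre p (Disk p) (translate n L)) hm
    rcases le_or_gt n (min a b) with h | h
    · rw [ha n (h.trans (min_le_left _ _)), ← ha (min a b) (min_le_left _ _)]
      exact key _ (Finset.mem_Icc.2 ⟨le_rfl, min_le_max⟩)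
    · rcases le_or_gt n (max a b) with h' | h'
      · exact key _ (Finset.mem_Icc.2 ⟨h.le, h'⟩)
      · rw [hb n ((le_max_right _ _).trans h'.le), ← hb (max a b) (le_max_right _ _)]
        exact key _ (Finset.mem_Icc.2 ⟨min_le_max, le_rfl⟩)
  refine ⟨?_⟩
  rw [show (⊤ : Submodule (Disk p) (Disk p ⊗[ℂ[X]] Und M)) = W from ?_]
  · exact hW
  symm
  rw [eq_top_iff]
  rintro x -
  induction x using TensorProduct.induction_on with
  | zero => exact zero_mem _
  | add x y hx hy => exact add_mem (hx) (hy)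
  | tmul c v =>
    rw [← mul_one c, ← smul_eq_mul, ← TensorProduct.smul_tmul']
    refine Submodule.smul_mem _ _ ?_
    have hv : v ∈ Submodule.span (DiffOp ℂ[X]) S := by rw [hS]; trivial
    induction hv using Submodule.closure_induction with
    | zero => simp
    | add x y _ _ hx hy => rw [TensorProduct.tmul_add]; exact add_mem hx hy
    | smul_mem d x hx =>
      rw [smul_eq_sum, TensorProduct.tmul_sum]
      refine Submodule.sum_mem _ fun g _ => ?_
      rw [TensorProduct.tmul_smul, ← algebraMap_smul (Disk p) (d.coeff g)]
      exact Submodule.smul_mem _ _ (hmem _ (Submodule.subset_span ⟨_, ⟨x, hSL hx, rfl⟩, rfl⟩))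

/-- The fibre of a holonomic difference module at the punctured formal disk is finite
dimensional. -/
lemma finite_fibre_punctured (hM : IsHolonomic A M) :
    Module.Finite (PuncturedDisk p) (PuncturedDisk p ⊗[ℂ[X]] Und M) := by
  classical
  obtain ⟨L, hL, -⟩ := exists_coherent hM
  rw [mem_coherent_iff] at hL
  obtain ⟨⟨S, hS⟩, hL⟩ := hL
  refine ⟨⟨S.image fun v => (1 : PuncturedDisk p) ⊗ₜ[ℂ[X]] v, ?_⟩⟩
  rw [eq_top_iff]
  rintro x -
  induction x using TensorProduct.induction_on with
  | zero => exact zero_mem _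
  | add x y hx hy => exact add_mem hx hy
  | tmul c v =>
    rw [← mul_one c, ← smul_eq_mul, ← TensorProduct.smul_tmul']
    refine Submodule.smul_mem _ _ ?_
    obtain ⟨f, hf, hv⟩ := hL v
    have hne : algebraMap ℂ[X] (PuncturedDisk p) f ≠ 0 := by
      rw [IsScalarTower.algebraMap_apply ℂ[X] (Disk p) (PuncturedDisk p)]
      intro e
      refine hf (expand_injective p ?_)
      rw [map_zero]
      exact IsFractionRing.injective (Disk p) (PuncturedDisk p) (e.trans (map_zero _).symm)
    have h1 : ∀ w ∈ L, (1 : PuncturedDisk p) ⊗ₜ[ℂ[X]] w ∈ Submodule.span (PuncturedDisk p)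
        ((S.image fun v => (1 : PuncturedDisk p) ⊗ₜ[ℂ[X]] v : Finset _) : Set _) := by
      intro w hw
      rw [← hS] at hw
      refine Submodule.span_induction (fun w hw => ?_) ?_ (fun x y _ _ hx hy => ?_)
        (fun f x _ hx => ?_) hw
      · exact Submodule.subset_span (Finset.mem_coe.2 (Finset.mem_image_of_mem _ hw))
      · simp
      · simp only [TensorProduct.tmul_add]; exact Submodule.add_mem _ hx hy
      · simp only [TensorProduct.tmul_smul, ← algebraMap_smul (PuncturedDisk p) f]
        exact Submodule.smul_mem _ _ hx
    have h2 := h1 _ hv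
    rw [TensorProduct.tmul_smul, ← algebraMap_smul (PuncturedDisk p) f] at h2
    exact (Submodule.smul_mem_iff _ hne).1 h2

end Ends

/-! ### Difference modules on the (punctured) formal disk -/

/-- An `O`-module `M` together with a "left" and a "right" submodule `Mˡ` and `Mʳ`. -/
structure LRModule (O : Type) [CommRing O] where
  /-- the underlying module `M` -/
  carrier : Type u
  [addCommGroup : AddCommGroup carrier]
  [module : Module O carrier]
  /-- the submodule `Mˡ` -/
  left : Submodule O carrier
  /-- the submodule `Mʳ` -/
  right : Submodule O carrier

namespace LRModule

attribute [instance] addCommGroup module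

variable {O : Type} [CommRing O]

/-- A morphism is an `O`-linear map respecting the left and the right submodules. -/
@[ext]
structure Hom (M N : LRModule.{u} O) where
  /-- the underlying linear map -/
  lin : M.carrier →ₗ[O] N.carrier
  map_left : ∀ x ∈ M.left, lin x ∈ N.left
  map_right : ∀ x ∈ M.right, lin x ∈ N.right

instance : Category (LRModule.{u} O) where
  Hom M N := Hom M N
  id M := ⟨LinearMap.id, fun _ h => h, fun _ h => h⟩
  comp f g := ⟨g.lin ∘ₗ f.lin, fun x h => g.map_left _ (f.map_left x h),
    fun x h => g.map_right _ (f.map_right x h)⟩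

@[ext]
lemma hom_ext {M N : LRModule.{u} O} {f g : M ⟶ N} (h : f.lin = g.lin) : f = g := Hom.ext h

@[simp] lemma id_lin (M : LRModule.{u} O) : Hom.lin (𝟙 M) = LinearMap.id := rfl

@[simp] lemma comp_lin {M N P : LRModule.{u} O} (f : M ⟶ N) (g : N ⟶ P) :
    Hom.lin (f ≫ g) = g.lin ∘ₗ f.lin := rfl

/-- An isomorphism is a linear equivalence matching the left and the right submodules. -/
def isoOfEquiv {M N : LRModule.{u} O} (e : M.carrier ≃ₗ[O] N.carrier)
    (hl : M.left.map e.toLinearMap = N.left) (hr : M.right.map e.toLinearMap = N.right) :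
    M ≅ N where
  hom := ⟨e.toLinearMap, fun x h => hl ▸ Submodule.mem_map_of_mem h,
    fun x h => hr ▸ Submodule.mem_map_of_mem h⟩
  inv := ⟨e.symm.toLinearMap,
    fun x h => by
      rw [← hl] at h
      obtain ⟨y, hy, rfl⟩ := h
      simpa using hy,
    fun x h => by
      rw [← hr] at h
      obtain ⟨y, hy, rfl⟩ := h
      simpa using hy⟩
  hom_inv_id := by ext x; exact e.symm_apply_apply x
  inv_hom_id := by ext x; exact e.apply_symm_apply x

end LRModule

/-- The objects of the category of difference modules on the formal disk at `p`: `M` is a finitely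
generated `ℂ⟦π⟧`-module, and `Mˡ`, `Mʳ` are free of finite rank, with torsion quotients `M / Mˡ`
and `M / Mʳ` (these quotients, being finitely generated, are then finite dimensional over `ℂ`). -/
structure IsDiskModule (p : ℂ) (M : LRModule.{u} (Disk p)) : Prop where
  finite : Module.Finite (Disk p) M.carrier
  left : IsFreeCotorsion M.left
  right : IsFreeCotorsion M.right

/-- The objects of the category of difference modules on the punctured formal disk at `p`: `M` is
a finite dimensional vector space over `ℂ⸨π⸩` (this structure is unique, if it exists), and
`Mˡ`, `Mʳ` are `ℂ⟦π⟧`-submodules that are free of finite rank, with torsion quotients `M / Mˡ`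
and `M / Mʳ`. -/
structure IsPuncturedDiskModule (p : ℂ) (M : LRModule.{u} (Disk p)) : Prop where
  finite : ∃ (_ : Module (PuncturedDisk p) M.carrier)
    (_ : IsScalarTower (Disk p) (PuncturedDisk p) M.carrier),
    Module.Finite (PuncturedDisk p) M.carrier
  left : IsFreeCotorsion M.left
  right : IsFreeCotorsion M.right

/-- The category of difference modules on the formal disk at `p`. -/
abbrev HolDisk (p : ℂ) : Type (u + 1) :=
  ObjectProperty.FullSubcategory (IsDiskModule.{u} p)

/-- The category of difference modules on the punctured formal disk at `p`. -/
abbrev HolPuncturedDisk (p : ℂ) : Type (u + 1) :=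
  ObjectProperty.FullSubcategory (IsPuncturedDiskModule.{u} p)

/-! ### Restriction from the formal disk to the punctured formal disk -/

section DiskToPunctured

variable (p : ℂ)

/-- The base change `ℂ⸨π⸩ ⊗ M`, with the images of `Mˡ` and `Mʳ`. -/
def puncture (M : LRModule.{u} (Disk p)) : LRModule.{u} (Disk p) where
  carrier := PuncturedDisk p ⊗[Disk p] M.carrier
  left := M.left.map (TensorProduct.mk (Disk p) (PuncturedDisk p) M.carrier 1)
  right := M.right.map (TensorProduct.mk (Disk p) (PuncturedDisk p) M.carrier 1)

variable {p}

lemma IsFreeCotorsion.map_mk {V : Type u} [AddCommGroup V] [Module (Disk p) V]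
    {N : Submodule (Disk p) V} (hN : IsFreeCotorsion N) :
    IsFreeCotorsion (N.map (TensorProduct.mk (Disk p) (PuncturedDisk p) V 1)) := by
  obtain ⟨h1, h2, h3⟩ := hN
  let j := TensorProduct.mk (Disk p) (PuncturedDisk p) V 1
  have hinj : Function.Injective (j.submoduleMap N) := by
    rw [injective_iff_map_eq_zero]
    intro x hx
    have hx : j x = 0 := congrArg Subtype.val hx
    obtain ⟨a, ha⟩ :=
      (IsLocalizedModule.eq_zero_iff (nonZeroDivisors (Disk p)) j).1 hx
    have : (a : Disk p) • x = 0 := Subtype.ext ha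
    exact (smul_eq_zero.1 this).resolve_left (nonZeroDivisors.coe_ne_zero a)
  let e := LinearEquiv.ofBijective (j.submoduleMap N) ⟨hinj, j.submoduleMap_surjective N⟩
  refine ⟨Module.Finite.equiv e, Module.Free.of_equiv e, fun x => ?_⟩
  obtain ⟨x, rfl⟩ := Submodule.Quotient.mk_surjective _ x
  obtain ⟨⟨v, s⟩, hv⟩ := IsLocalizedModule.surj (nonZeroDivisors (Disk p)) j x
  obtain ⟨a, ha⟩ := @h3 (Submodule.Quotient.mk v)
  have ha : (a : Disk p) • v ∈ N := (Submodule.Quotient.mk_eq_zero N).1 ha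
  refine ⟨a * s, (Submodule.Quotient.mk_eq_zero _).2 ⟨_, ha, ?_⟩⟩
  change j _ = _
  rw [map_smul, ← hv]
  exact (mul_smul (a : Disk p) (s : Disk p) x).symm

lemma puncture_spec {M : LRModule.{u} (Disk p)} (hM : IsDiskModule p M) :
    IsPuncturedDiskModule p (puncture p M) where
  finite := by
    have := hM.finite
    exact ⟨inferInstanceAs (Module (PuncturedDisk p) (PuncturedDisk p ⊗[Disk p] M.carrier)),
      inferInstanceAs (IsScalarTower (Disk p) (PuncturedDisk p)
        (PuncturedDisk p ⊗[Disk p] M.carrier)), Module.Finite.base_change _ _ _⟩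
  left := hM.left.map_mk
  right := hM.right.map_mk

variable (p)

/-- The functor of restriction to the punctured formal disk,
`(Mˡ, M, Mʳ) ↦ (image of Mˡ, ℂ⸨π⸩ ⊗ M, image of Mʳ)`. -/
def diskToPuncturedDisk : HolDisk.{u} p ⥤ HolPuncturedDisk.{u} p where
  obj M := ⟨puncture p M.obj, puncture_spec M.property⟩
  map {M N} f := ObjectProperty.homMk
    { lin := TensorProduct.AlgebraTensorModule.lTensor (Disk p) (PuncturedDisk p) f.hom.lin
      map_left := by
        rintro _ ⟨x, hx, rfl⟩
        exact ⟨_, f.hom.map_left x hx, rfl⟩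
      map_right := by
        rintro _ ⟨x, hx, rfl⟩
        exact ⟨_, f.hom.map_right x hx, rfl⟩ }
  map_id M := by
    ext : 1
    refine LRModule.hom_ext ?_
    exact TensorProduct.AlgebraTensorModule.lTensor_id
  map_comp f g := by
    ext : 1
    refine LRModule.hom_ext ?_
    exact TensorProduct.AlgebraTensorModule.lTensor_comp _ _

end DiskToPunctured

/-! ### Restriction from the (punctured) line to the (punctured) formal disk -/

section LineToDisk

variable (p : ℂ) {A : Type} [CommRing A] [MulSemiringAction Translations A] [Algebra ℂ[X] A]
  [IsLine A]
  (E : Type) [CommRing E] [Algebra ℂ[X] E] [Algebra (Disk p) E] [IsScalarTower ℂ[X] (Disk p) E]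

/-- The formal fibre `E ⊗ M` of a difference module, together with the submodules `(τⁿ L)_p`
and `(τ⁻ⁿ L)_p` for `L ∈ 𝓢(M)` and `n ≫ 0`. -/
def restrict (M : ModuleCat.{u} (DiffOp A)) : LRModule.{u} (Disk p) where
  carrier := E ⊗[ℂ[X]] Und M
  left := endLattice p E atTop M
  right := endLattice p E atBot M

/-- A morphism of difference modules is linear over the functions. -/
def undMap {M N : ModuleCat.{u} (DiffOp A)} (f : M ⟶ N) : Und M →ₗ[ℂ[X]] Und N where
  toFun v := f.hom v
  map_add' := map_add f.hom
  map_smul' a := map_smul f.hom (coeffHom A (algebraMap ℂ[X] A a))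

/-- The map induced by a morphism of difference modules on the formal fibres. -/
def fibreMap {M N : ModuleCat.{u} (DiffOp A)} (f : M ⟶ N) :
    E ⊗[ℂ[X]] Und M →ₗ[Disk p] E ⊗[ℂ[X]] Und N :=
  TensorProduct.AlgebraTensorModule.lTensor (Disk p) E (undMap f)

variable {p E}

lemma fibreMap_mem {M N : ModuleCat.{u} (DiffOp A)} (hM : IsHolonomic A M)
    (hN : IsHolonomic A N) (f : M ⟶ N) {l : Filter ℤ} (hl : IsEnd l)
    {x : E ⊗[ℂ[X]] Und M} (hx : x ∈ endLattice p E l M) :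
    fibreMap p E f x ∈ endLattice p E l N := by
  have := hl.neBot
  obtain ⟨L, hL, -⟩ := exists_coherent hM
  obtain ⟨L', hL', -⟩ := exists_coherent hN
  have hfg : (L.map (undMap f)).FG := hL.1.map _
  have h3 := hl.le (eventually_formalFibre_le (p := p) (E := E) hfg hL')
  obtain ⟨n, h1, h2, h3⟩ := ((endLattice_eq (p := p) (E := E) hl hL).and
    ((endLattice_eq (p := p) (E := E) hl hL').and h3)).exists
  rw [← h1] at hx
  rw [← h2]
  refine h3 ?_
  suffices h : formalFibre p E (translate n L) ≤
      (formalFibre p E (translate n (L.map (undMap f)))).comap (fibreMap p E f) from h hx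
  refine Submodule.span_le.2 ?_
  rintro _ ⟨_, ⟨v, hv, rfl⟩, rfl⟩
  refine Submodule.subset_span ⟨_, ⟨_, ⟨v, hv, rfl⟩, rfl⟩, ?_⟩
  change (1 : E) ⊗ₜ[ℂ[X]] (tau A n • (undMap f v)) = (1 : E) ⊗ₜ[ℂ[X]] (undMap f (tau A n • v))
  congr 1
  exact (map_smul f.hom (tau A n) v).symm

variable (p E)

/-- Restriction, as a morphism in the category of modules with left and right submodules. -/
def restrictMap {M N : Hol.{u} A} (f : M ⟶ N) : restrict p E M.obj ⟶ restrict p E N.obj where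
  lin := fibreMap p E f.hom
  map_left _ hx := fibreMap_mem M.property N.property f.hom (Or.inl rfl) hx
  map_right _ hx := fibreMap_mem M.property N.property f.hom (Or.inr rfl) hx

lemma restrictMap_id (M : Hol.{u} A) : restrictMap p E (𝟙 M) = 𝟙 _ := by
  refine LRModule.hom_ext ?_
  exact TensorProduct.AlgebraTensorModule.lTensor_id

lemma restrictMap_comp {M N P : Hol.{u} A} (f : M ⟶ N) (g : N ⟶ P) :
    restrictMap p E (f ≫ g) = restrictMap p E f ≫ restrictMap p E g := by
  refine LRModule.hom_ext ?_
  exact TensorProduct.AlgebraTensorModule.lTensor_comp (undMap g.hom) (undMap f.hom)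

end LineToDisk

/-- The functor `|_{U_p}` of restriction of holonomic difference modules on the line to the formal
disk: `M ↦ ((τⁿ L)_p, M_p, (τ⁻ⁿ L)_p)` with `M_p = ℂ⟦z - p⟧ ⊗ M`. -/
def lineToDisk (p : ℂ) : Hol.{u} ℂ[X] ⥤ HolDisk.{u} p where
  obj M := ⟨restrict p (Disk p) M.obj,
    { finite := finite_fibre_line M.property
      left := endLattice_spec M.property (Or.inl rfl)
      right := endLattice_spec M.property (Or.inr rfl) }⟩
  map f := ObjectProperty.homMk (restrictMap p (Disk p) f)
  map_id M := by ext : 1; exact restrictMap_id p (Disk p) M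
  map_comp f g := by ext : 1; exact restrictMap_comp p (Disk p) f g

/-- The functor `|_{U_p^*}` of restriction of holonomic difference modules on the punctured line
to the punctured formal disk: `M ↦ ((τⁿ L)_p, M_p, (τ⁻ⁿ L)_p)`. As `z - p` acts invertibly on
`M`, the formal fibre `M_p = ℂ⟦z - p⟧ ⊗ M` is the vector space `ℂ⸨z - p⸩ ⊗ M`. -/
def puncturedLineToPuncturedDisk (p : ℂ) :
    Hol.{u} (PuncturedLine p) ⥤ HolPuncturedDisk.{u} p where
  obj M := ⟨restrict p (PuncturedDisk p) M.obj,
    { finite := ⟨inferInstanceAs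
          (Module (PuncturedDisk p) (PuncturedDisk p ⊗[ℂ[X]] Und M.obj)),
        inferInstanceAs
          (IsScalarTower (Disk p) (PuncturedDisk p) (PuncturedDisk p ⊗[ℂ[X]] Und M.obj)),
        finite_fibre_punctured M.property⟩
      left := endLattice_spec M.property (Or.inl rfl)
      right := endLattice_spec M.property (Or.inr rfl) }⟩
  map f := ObjectProperty.homMk (restrictMap p (PuncturedDisk p) f)
  map_id M := by ext : 1; exact restrictMap_id p (PuncturedDisk p) M
  map_comp f g := by ext : 1; exact restrictMap_comp p (PuncturedDisk p) f g

/-! ### Restriction from the line to the punctured line -/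

section BaseChange

variable (B : Type) [CommRing B] [MulSemiringAction Translations B] [Algebra ℂ[X] B] [IsLine B]
  (M : ModuleCat.{u} (DiffOp ℂ[X]))

/-- The operator `b ⊗ m ↦ (g • b) ⊗ (g • m)` on `B ⊗ M`, for `g = τⁿ`. -/
def diagonal (g : Translations) : B ⊗[ℂ[X]] Und M →+ B ⊗[ℂ[X]] Und M :=
  TensorProduct.liftAddHom
    { toFun := fun b =>
        { toFun := fun m => (g • b) ⊗ₜ[ℂ[X]] (tau ℂ[X] (Multiplicative.toAdd g) • m)
          map_zero' := by simp
          map_add' := fun x y => by rw [smul_add, TensorProduct.tmul_add] }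
      map_zero' := by ext; simp
      map_add' := fun x y => by ext m; simp [smul_add, TensorProduct.add_tmul] }
    fun f b m => by
      change (g • (f • b)) ⊗ₜ[ℂ[X]] (tau ℂ[X] (Multiplicative.toAdd g) • m) =
        (g • b) ⊗ₜ[ℂ[X]] (tau ℂ[X] (Multiplicative.toAdd g) • (f • m))
      rw [tau_smul_poly, Algebra.smul_def, smul_mul', IsLine.smul_algebraMap, ← Algebra.smul_def,
        TensorProduct.smul_tmul]
      rfl

variable {B M}

lemma diagonal_tmul (g : Translations) (b : B) (m : Und M) :
    diagonal B M g (b ⊗ₜ m) = (g • b) ⊗ₜ (tau ℂ[X] (Multiplicative.toAdd g) • m) := rfl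

lemma diagonal_one (x : B ⊗[ℂ[X]] Und M) : diagonal B M 1 x = x := by
  induction x using TensorProduct.induction_on with
  | zero => exact map_zero _
  | add x y hx hy => rw [map_add, hx, hy]
  | tmul b m => simp [diagonal_tmul, tau_zero_smul]

lemma diagonal_mul (g h : Translations) (x : B ⊗[ℂ[X]] Und M) :
    diagonal B M (g * h) x = diagonal B M g (diagonal B M h x) := by
  induction x using TensorProduct.induction_on with
  | zero => simp only [map_zero]
  | add x y hx hy => simp only [map_add, hx, hy]
  | tmul b m => simp only [diagonal_tmul, mul_smul, tau_tau, toAdd_mul]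

variable (B M)

/-- The diagonal operators form an action of the group of translations. -/
def diagonalHom : Translations →* AddMonoid.End (B ⊗[ℂ[X]] Und M) where
  toFun := diagonal B M
  map_one' := AddMonoidHom.ext diagonal_one
  map_mul' g h := AddMonoidHom.ext (diagonal_mul g h)

/-- The action of the difference operators on `B ⊗ M`: functions act on the left factor, and
`τ (b ⊗ m) = τ(b) ⊗ τ m`. -/
def diffOpToEnd : DiffOp B →+* AddMonoid.End (B ⊗[ℂ[X]] Und M) :=
  SkewMonoidAlgebra.liftNCRingHom (Module.toAddMonoidEnd B (B ⊗[ℂ[X]] Und M)) (diagonalHom B M)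
    fun {b g} => by
      refine AddMonoidHom.ext fun x => ?_
      change (g • b) • diagonal B M g x = diagonal B M g (b • x)
      induction x using TensorProduct.induction_on with
      | zero => simp
      | add x y hx hy => rw [smul_add, map_add, map_add, smul_add, hx, hy]
      | tmul c m =>
        simp only [diagonal_tmul, TensorProduct.smul_tmul', smul_eq_mul, smul_mul']

instance instModuleBaseChange : Module (DiffOp B) (B ⊗[ℂ[X]] Und M) :=
  Module.compHom _ (diffOpToEnd B M)

/-- The base change `B ⊗ M` of a difference module. -/
def baseChange : ModuleCat.{u} (DiffOp B) := ModuleCat.of (DiffOp B) (B ⊗[ℂ[X]] Und M)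

variable {B M}

lemma single_smul_baseChange (g : Translations) (b : B) (x : B ⊗[ℂ[X]] Und M) :
    (SkewMonoidAlgebra.single g b : DiffOp B) • x = b • diagonal B M g x := by
  have h : diffOpToEnd B M (SkewMonoidAlgebra.single g b) =
      Module.toAddMonoidEnd B (B ⊗[ℂ[X]] Und M) b * diagonalHom B M g :=
    SkewMonoidAlgebra.liftNC_single _ _ _ _
  exact DFunLike.congr_fun h x

lemma coeffHom_smul_baseChange (b : B) (x : B ⊗[ℂ[X]] Und M) : coeffHom B b • x = b • x := by
  have := single_smul_baseChange 1 b x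
  rwa [diagonal_one] at this

lemma tau_smul_baseChange (n : ℤ) (b : B) (m : Und M) :
    tau B n • (b ⊗ₜ[ℂ[X]] m) = (tpow n • b) ⊗ₜ[ℂ[X]] (tau ℂ[X] n • m) := by
  have := single_smul_baseChange (tpow n) (1 : B) (b ⊗ₜ[ℂ[X]] m)
  rwa [one_smul] at this

/-- The identification of the underlying module of `B ⊗ M` with `B ⊗ M`. -/
def undBaseChange : Und (baseChange B M) ≃ₗ[ℂ[X]] B ⊗[ℂ[X]] Und M where
  toFun x := x
  invFun x := x
  map_add' _ _ := rfl
  map_smul' f x := by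
    change coeffHom B (algebraMap ℂ[X] B f) • (show B ⊗[ℂ[X]] Und M from x) = _
    rw [coeffHom_smul_baseChange, algebraMap_smul]
    rfl
  left_inv _ := rfl
  right_inv _ := rfl

variable (B M)

/-- The canonical map `m ↦ 1 ⊗ m` from `M` to its base change. -/
def toBaseChange : Und M →ₗ[ℂ[X]] Und (baseChange B M) :=
  undBaseChange.symm.toLinearMap ∘ₗ TensorProduct.mk ℂ[X] B (Und M) 1

variable {B M}

lemma tau_toBaseChange (n : ℤ) (m : Und M) :
    tau B n • toBaseChange B M m = toBaseChange B M (tau ℂ[X] n • m) := by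
  change tau B n • ((1 : B) ⊗ₜ[ℂ[X]] m) = (1 : B) ⊗ₜ[ℂ[X]] (tau ℂ[X] n • m)
  rw [tau_smul_baseChange, smul_one]

/-- The map of difference modules induced on base changes. -/
def baseChangeMap {M N : ModuleCat.{u} (DiffOp ℂ[X])} (f : M ⟶ N) :
    baseChange B M ⟶ baseChange B N :=
  ModuleCat.ofHom (X := B ⊗[ℂ[X]] Und M) (Y := B ⊗[ℂ[X]] Und N)
    { toFun := TensorProduct.AlgebraTensorModule.lTensor B B (undMap f)
      map_add' := map_add _
      map_smul' := by
        intro d x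
        induction d using SkewMonoidAlgebra.induction_on with
        | zero => simp
        | single g b =>
          rw [RingHom.id_apply, single_smul_baseChange, single_smul_baseChange, map_smul]
          congr 1
          induction x using TensorProduct.induction_on with
          | zero => simp
          | add x y hx hy => simp only [map_add, hx, hy]
          | tmul c m =>
            change (g • c) ⊗ₜ[ℂ[X]] (undMap f (tau ℂ[X] (Multiplicative.toAdd g) • m)) =
              (g • c) ⊗ₜ[ℂ[X]] (tau ℂ[X] (Multiplicative.toAdd g) • (undMap f m))
            congr 1
            exact map_smul f.hom (tau ℂ[X] (Multiplicative.toAdd g)) m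
        | add d e hd he =>
          simp only [RingHom.id_apply, add_smul, map_add] at hd he ⊢
          rw [hd, he] }

end BaseChange

section PuncturedLine

variable (p : ℂ) {M : ModuleCat.{u} (DiffOp ℂ[X])}

/-- Extension of the coefficients of a difference operator. -/
def extendOp : DiffOp ℂ[X] →+* DiffOp (PuncturedLine p) :=
  SkewMonoidAlgebra.liftNCRingHom
    ((coeffHom (PuncturedLine p)).comp (algebraMap ℂ[X] (PuncturedLine p)))
    (SkewMonoidAlgebra.of (PuncturedLine p) Translations)
    fun {f g} => by
      have := tau_mul_coeff (A := PuncturedLine p) (Multiplicative.toAdd g)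
        (algebraMap ℂ[X] (PuncturedLine p) f)
      rw [IsLine.smul_algebraMap] at this
      exact this.symm

lemma extendOp_single (g : Translations) (f : ℂ[X]) :
    extendOp p (SkewMonoidAlgebra.single g f) =
      SkewMonoidAlgebra.single g (algebraMap ℂ[X] (PuncturedLine p) f) := by
  change SkewMonoidAlgebra.liftNC _ _ _ = _
  rw [SkewMonoidAlgebra.liftNC_single]
  change SkewMonoidAlgebra.single _ _ * SkewMonoidAlgebra.single _ _ = _
  simp [SkewMonoidAlgebra.single_mul_single]

lemma extendOp_coeff (d : DiffOp ℂ[X]) (g : Translations) :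
    (extendOp p d).coeff g = algebraMap ℂ[X] (PuncturedLine p) (d.coeff g) := by
  classical
  induction d using SkewMonoidAlgebra.induction_on with
  | zero => simp
  | single h f =>
    rw [extendOp_single, SkewMonoidAlgebra.coeff_single, SkewMonoidAlgebra.coeff_single,
      Finsupp.single_apply, Finsupp.single_apply]
    split_ifs <;> simp
  | add d e hd he =>
    rw [map_add, SkewMonoidAlgebra.coeff_add, SkewMonoidAlgebra.coeff_add, Finsupp.add_apply,
      Finsupp.add_apply, hd, he, map_add]

lemma extendOp_ne_zero {d : DiffOp ℂ[X]} (hd : d ≠ 0) : extendOp p d ≠ 0 := by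
  intro h
  refine hd (SkewMonoidAlgebra.ext fun g => ?_)
  refine IsLine.injective (A := PuncturedLine p) ?_
  rw [← extendOp_coeff, h]
  simp

lemma extendOp_smul (d : DiffOp ℂ[X]) (m : Und M) :
    extendOp p d • ((1 : PuncturedLine p) ⊗ₜ[ℂ[X]] m) = (1 : PuncturedLine p) ⊗ₜ[ℂ[X]] (d • m) := by
  induction d using SkewMonoidAlgebra.induction_on with
  | zero => simp
  | single g f =>
    rw [extendOp_single, single_smul_baseChange, diagonal_tmul, smul_one, algebraMap_smul,
      ← TensorProduct.tmul_smul]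
    congr 1
    rw [und_smul_def, ← mul_smul]
    congr 1
    change SkewMonoidAlgebra.single _ _ * SkewMonoidAlgebra.single _ _ = _
    simp [SkewMonoidAlgebra.single_mul_single, tpow]
  | add d e hd he => rw [map_add, add_smul, add_smul, TensorProduct.tmul_add, hd, he]

lemma exists_smul_eq_mk (x : PuncturedLine p ⊗[ℂ[X]] Und M) :
    ∃ s ∈ orbitMonoid p, ∃ m : Und M, s • x = (1 : PuncturedLine p) ⊗ₜ[ℂ[X]] m := by
  obtain ⟨⟨m, s⟩, h⟩ := IsLocalizedModule.surj (orbitMonoid p)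
    (TensorProduct.mk ℂ[X] (PuncturedLine p) (Und M) 1) x
  exact ⟨s, s.2, m, h⟩

lemma baseChange_holonomic (hM : IsHolonomic ℂ[X] M) :
    IsHolonomic (PuncturedLine p) (baseChange (PuncturedLine p) M) := by
  classical
  obtain ⟨⟨hS⟩, hM⟩ := hM
  obtain ⟨S, hS⟩ : ∃ S : Finset (Und M), Submodule.span (DiffOp ℂ[X]) (S : Set (Und M)) = ⊤ := hS
  constructor
  · change Module.Finite (DiffOp (PuncturedLine p)) (PuncturedLine p ⊗[ℂ[X]] Und M)
    refine ⟨⟨S.image fun v => (1 : PuncturedLine p) ⊗ₜ[ℂ[X]] v, ?_⟩⟩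
    rw [eq_top_iff]
    rintro x -
    induction x using TensorProduct.induction_on with
    | zero => exact zero_mem _
    | add x y hx hy => exact add_mem hx hy
    | tmul c m =>
      rw [← mul_one c, ← smul_eq_mul, ← TensorProduct.smul_tmul', ← coeffHom_smul_baseChange]
      refine Submodule.smul_mem _ _ ?_
      have hm : m ∈ Submodule.span (DiffOp ℂ[X]) (S : Set (Und M)) := by rw [hS]; trivial
      refine Submodule.span_induction (fun w hw => ?_) ?_ (fun x y _ _ hx hy => ?_)
        (fun d x _ hx => ?_) hm
      · exact Submodule.subset_span (Finset.mem_coe.2 (Finset.mem_image_of_mem _ hw))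
      · simp
      · rw [TensorProduct.tmul_add]; exact Submodule.add_mem _ hx hy
      · rw [← extendOp_smul]; exact Submodule.smul_mem _ _ hx
  · intro x
    obtain ⟨s, hs, m, h⟩ := exists_smul_eq_mk p (M := M) x
    obtain ⟨d, hd, hdm⟩ := hM m
    have hu : IsUnit (coeffHom (PuncturedLine p) (algebraMap ℂ[X] (PuncturedLine p) s)) :=
      (IsLocalization.map_units (PuncturedLine p) (⟨s, hs⟩ : orbitMonoid p)).map _
    refine ⟨extendOp p d * coeffHom (PuncturedLine p) (algebraMap ℂ[X] (PuncturedLine p) s),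
      fun e => extendOp_ne_zero p hd (hu.mul_left_eq_zero.1 e), ?_⟩
    have key : ∀ x : PuncturedLine p ⊗[ℂ[X]] Und M, s • x = (1 : PuncturedLine p) ⊗ₜ[ℂ[X]] m →
        (extendOp p d * coeffHom (PuncturedLine p) (algebraMap ℂ[X] (PuncturedLine p) s)) • x =
          0 := by
      intro x h
      rw [mul_smul, coeffHom_smul_baseChange, algebraMap_smul, h, extendOp_smul]
      exact (congrArg _ hdm).trans (TensorProduct.tmul_zero _ _)
    exact key x h

/-- The functor `|_{𝔸¹*}` of restriction of holonomic difference modules to the punctured line,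
`M ↦ ℂ[z, 1 / (z - p - i) : i ∈ ℤ] ⊗ M`. -/
def lineToPuncturedLine : Hol.{u} ℂ[X] ⥤ Hol.{u} (PuncturedLine p) where
  obj M := ⟨baseChange (PuncturedLine p) M.obj, baseChange_holonomic p M.property⟩
  map f := ObjectProperty.homMk (baseChangeMap f.hom)
  map_id M := by
    ext x
    exact LinearMap.congr_fun (TensorProduct.AlgebraTensorModule.lTensor_id
      (A := PuncturedLine p) (R := ℂ[X]) (M := PuncturedLine p) (N := Und M.obj)) x
  map_comp f g := by
    ext x
    exact LinearMap.congr_fun (TensorProduct.AlgebraTensorModule.lTensor_comp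
      (A := PuncturedLine p) (R := ℂ[X]) (M := PuncturedLine p) (undMap g.hom) (undMap f.hom)) x

end PuncturedLine

/-! ### The commutative square -/

section Square

variable (p : ℂ)

/-- The canonical map `ℂ⸨π⸩ ⊗ M → ℂ⸨π⸩ ⊗ (M|_{𝔸¹*})`. -/
def fibreBaseChange (M : ModuleCat.{u} (DiffOp ℂ[X])) :
    PuncturedDisk p ⊗[ℂ[X]] Und M →ₗ[Disk p]
      PuncturedDisk p ⊗[ℂ[X]] Und (baseChange (PuncturedLine p) M) :=
  TensorProduct.AlgebraTensorModule.lTensor (Disk p) (PuncturedDisk p)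
    (toBaseChange (PuncturedLine p) M)

variable {p} in
lemma algebraMap_ne_zero {f : ℂ[X]} (hf : f ≠ 0) : algebraMap ℂ[X] (PuncturedDisk p) f ≠ 0 := by
  rw [IsScalarTower.algebraMap_apply ℂ[X] (Disk p) (PuncturedDisk p)]
  intro e
  refine hf (expand_injective p ?_)
  rw [map_zero]
  exact IsFractionRing.injective (Disk p) (PuncturedDisk p) (e.trans (map_zero _).symm)

lemma fibreBaseChange_bijective (M : ModuleCat.{u} (DiffOp ℂ[X])) :
    Function.Bijective (fibreBaseChange p M) := by
  have hloc : IsLocalizedModule (orbitMonoid p) (toBaseChange (PuncturedLine p) M) :=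
    IsLocalizedModule.of_linearEquiv (orbitMonoid p)
      (TensorProduct.mk ℂ[X] (PuncturedLine p) (Und M) 1) undBaseChange.symm
  constructor
  · rw [injective_iff_map_eq_zero]
    intro x hx
    have h1 : TensorProduct.AlgebraTensorModule.rTensor ℂ[X] (PuncturedDisk p)
        (toBaseChange (PuncturedLine p) M) (TensorProduct.comm ℂ[X] _ _ x) = 0 := by
      rw [← map_zero (TensorProduct.comm ℂ[X] (PuncturedDisk p)
        (Und (baseChange (PuncturedLine p) M))), ← hx]
      clear hx
      induction x using TensorProduct.induction_on with
      | zero => simp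
      | tmul k m => rfl
      | add x y hx hy => simp only [map_add, hx, hy]
    obtain ⟨⟨s, hs⟩, h⟩ := (IsLocalizedModule.eq_zero_iff (orbitMonoid p) _).1 h1
    have h : s • TensorProduct.comm ℂ[X] _ _ x = 0 := h
    rw [← map_smul, LinearEquiv.map_eq_zero_iff, ← algebraMap_smul (PuncturedDisk p) s] at h
    exact (smul_eq_zero.1 h).resolve_left
      (algebraMap_ne_zero (nonZeroDivisors.ne_zero (orbitMonoid_le p hs)))
  · intro x
    induction x using TensorProduct.induction_on with
    | zero => exact ⟨0, map_zero _⟩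
    | add x y hx hy =>
      obtain ⟨x, rfl⟩ := hx
      obtain ⟨y, rfl⟩ := hy
      exact ⟨x + y, map_add _ _ _⟩
    | tmul k w =>
      obtain ⟨⟨m, s, hs⟩, h⟩ := IsLocalizedModule.surj (orbitMonoid p)
        (toBaseChange (PuncturedLine p) M) w
      have h : s • w = toBaseChange (PuncturedLine p) M m := h
      have hs0 := algebraMap_ne_zero (p := p) (nonZeroDivisors.ne_zero (orbitMonoid_le p hs))
      refine ⟨(k * (algebraMap ℂ[X] (PuncturedDisk p) s)⁻¹) ⊗ₜ m, ?_⟩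
      change (k * (algebraMap ℂ[X] (PuncturedDisk p) s)⁻¹) ⊗ₜ[ℂ[X]]
        (toBaseChange (PuncturedLine p) M m) = _
      rw [← h, ← TensorProduct.smul_tmul, Algebra.smul_def, mul_left_comm, mul_inv_cancel₀ hs0,
        mul_one]

/-- The canonical isomorphism `ℂ⸨π⸩ ⊗ (ℂ⟦π⟧ ⊗ M) ≃ ℂ⸨π⸩ ⊗ (M|_{𝔸¹*})`, which maps
`k ⊗ (a ⊗ m)` to `k a ⊗ (1 ⊗ m)`. -/
def squareEquiv (M : ModuleCat.{u} (DiffOp ℂ[X])) :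
    PuncturedDisk p ⊗[Disk p] (Disk p ⊗[ℂ[X]] Und M) ≃ₗ[Disk p]
      PuncturedDisk p ⊗[ℂ[X]] Und (baseChange (PuncturedLine p) M) :=
  (TensorProduct.AlgebraTensorModule.cancelBaseChange ℂ[X] (Disk p) (Disk p)
    (PuncturedDisk p) (Und M)).trans
    (LinearEquiv.ofBijective (fibreBaseChange p M) (fibreBaseChange_bijective p M))

lemma squareEquiv_tmul (M : ModuleCat.{u} (DiffOp ℂ[X])) (k : PuncturedDisk p) (a : Disk p)
    (m : Und M) : squareEquiv p M (k ⊗ₜ (a ⊗ₜ m)) =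
      (a • k) ⊗ₜ toBaseChange (PuncturedLine p) M m := by
  simp only [squareEquiv, LinearEquiv.trans_apply,
    TensorProduct.AlgebraTensorModule.cancelBaseChange_tmul]
  rfl

variable {p} in
lemma map_mem_coherent {M : ModuleCat.{u} (DiffOp ℂ[X])} {L : Submodule ℂ[X] (Und M)}
    (hL : L ∈ coherentSubmodules M) :
    L.map (toBaseChange (PuncturedLine p) M) ∈
      coherentSubmodules (baseChange (PuncturedLine p) M) := by
  rw [mem_coherent_iff] at hL ⊢
  refine ⟨hL.1.map _, fun w => ?_⟩
  obtain ⟨s, hs, m, h⟩ := exists_smul_eq_mk p (M := M) (undBaseChange w)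
  obtain ⟨f, hf, hv⟩ := hL.2 m
  refine ⟨f * s, mul_ne_zero hf (nonZeroDivisors.ne_zero (orbitMonoid_le p hs)), f • m, hv, ?_⟩
  rw [map_smul, mul_smul]
  congr 1
  refine undBaseChange.injective ?_
  rw [map_smul, h]
  rfl

variable {p} in
lemma map_endLattice {M : ModuleCat.{u} (DiffOp ℂ[X])} (hM : IsHolonomic ℂ[X] M)
    {l : Filter ℤ} (hl : IsEnd l) :
    ((endLattice p (Disk p) l M).map (TensorProduct.mk (Disk p) (PuncturedDisk p) _ 1)).map
      (squareEquiv p M).toLinearMap =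
    endLattice p (PuncturedDisk p) l (baseChange (PuncturedLine p) M) := by
  have := hl.neBot
  obtain ⟨L, hL, -⟩ := exists_coherent hM
  obtain ⟨n, h1, h2⟩ := ((endLattice_eq (p := p) (E := Disk p) hl hL).and
    (endLattice_eq (p := p) (E := PuncturedDisk p) hl (map_mem_coherent hL))).exists
  rw [← h1, ← h2, formalFibre, formalFibre, Submodule.map_span, Submodule.map_span]
  congr 1
  ext x
  constructor
  · rintro ⟨_, ⟨_, ⟨_, ⟨v, hv, rfl⟩, rfl⟩, rfl⟩, rfl⟩
    refine ⟨_, ⟨_, ⟨v, hv, rfl⟩, rfl⟩, ?_⟩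
    change _ = squareEquiv p M (1 ⊗ₜ (1 ⊗ₜ (tau ℂ[X] n • v)))
    rw [squareEquiv_tmul, one_smul, ← tau_toBaseChange]
  · rintro ⟨_, ⟨_, ⟨v, hv, rfl⟩, rfl⟩, rfl⟩
    refine ⟨_, ⟨_, ⟨_, ⟨v, hv, rfl⟩, rfl⟩, rfl⟩, ?_⟩
    change squareEquiv p M (1 ⊗ₜ (1 ⊗ₜ (tau ℂ[X] n • v))) = _
    rw [squareEquiv_tmul, one_smul, ← tau_toBaseChange]

lemma squareEquiv_naturality {M N : ModuleCat.{u} (DiffOp ℂ[X])} (f : M ⟶ N)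
    (x : PuncturedDisk p ⊗[Disk p] (Disk p ⊗[ℂ[X]] Und M)) :
    squareEquiv p N (TensorProduct.AlgebraTensorModule.lTensor (Disk p) (PuncturedDisk p)
      (fibreMap p (Disk p) f) x) =
    fibreMap p (PuncturedDisk p) (baseChangeMap f) (squareEquiv p M x) := by
  induction x using TensorProduct.induction_on with
  | zero => simp only [map_zero]
  | add x y hx hy => simp only [map_add, hx, hy]
  | tmul k y =>
    induction y using TensorProduct.induction_on with
    | zero => simp only [TensorProduct.tmul_zero, map_zero]
    | add x y hx hy => simp only [TensorProduct.tmul_add, map_add, hx, hy]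
    | tmul a m =>
      rw [squareEquiv_tmul]
      exact squareEquiv_tmul p N k a (undMap f m)

/-- The canonical natural isomorphism making the square of restrictions commute. -/
def squareIso : lineToDisk.{u} p ⋙ diskToPuncturedDisk p ≅
    lineToPuncturedLine p ⋙ puncturedLineToPuncturedDisk p :=
  NatIso.ofComponents
    (fun M => ObjectProperty.isoMk _ (LRModule.isoOfEquiv (squareEquiv p M.obj)
      (map_endLattice M.property (Or.inl rfl)) (map_endLattice M.property (Or.inr rfl))))
    (fun {M N} f => by
      ext : 1
      exact LRModule.hom_ext (LinearMap.ext fun x => squareEquiv_naturality p f.hom x))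

/-- The commutative square of restrictions of holonomic difference modules. -/
def restrictionSquare : CategoricalPullback.CatCommSqOver (diskToPuncturedDisk.{u} p)
    (puncturedLineToPuncturedDisk.{u} p) (Hol.{u} ℂ[X]) where
  fst := lineToDisk p
  snd := lineToPuncturedLine p
  iso := squareIso p

end Square

end DifferenceModules

end

/-!
A holonomic difference module on the line is recovered from its restrictions to the punctured line
and to the formal disk by gluing. Let `W` be a holonomic module on the punctured line, let
`(Vˡ, V, Vʳ)` be an object over the formal disk at `p`, and identify `ℂ⸨π⸩ ⊗ V` with the fibre
of `W`. The glued module `Gluing.glued` consists of the families `(w, (vₙ))` with `w` in `W` and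
`vₙ` in `V`, for `n : ℤ`, such that `vₙ` lifts the expansion of `τⁿ w` at `p`, and such that
`vₙ` is in `Vˡ` for `n ≫ 0` and in `Vʳ` for `n ≪ 0`. As `τ` moves the points of the orbit `p + ℤ`
among each other, the `vₙ` describe the behaviour of a section at all these points, although `V`
lives at the single point `p`. The conditions at the ends force the torsion of a section to be
supported at finitely many points, since `Vˡ` and `Vʳ` are torsion free.

The glued module restricts to `W` on the punctured line (`Gluing.lineIso`): its sections may be
multiplied into `W` by functions with zeros on the orbit, because only finitely many conditions on
an element of `W` are not automatic. It restricts to `V` on the formal disk (`Gluing.diskEquiv`):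
surjectivity is weak approximation (`exists_one_tmul_add`), injectivity is flatness of `ℂ⟦π⟧` over
`ℂ[z]`. The lattices at the ends agree with `Vˡ` and `Vʳ` because they have the same images in the
fibre of `W` (`Gluing.map_endLattice_glued`).

A difference module supported on the orbit is zero as soon as it has no nonzero element annihilated
by `z - p` (`eq_zero_of_orbit_torsion`). Hence a submodule of the glued module that generates both
restrictions is everything (`Gluing.eq_top_of_generates`), which gives the finite generation of the
glued module, and also shows that a holonomic module on the line is the gluing of its own
restrictions (`isIso_liftTriple_id`). As morphisms from the triple of `M` to a triple `T` embed into
the morphisms from `M` to the module glued from `T` (`liftTriple_injective`), the functor is fully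
faithful, and it is essentially surjective since `T` is isomorphic to the triple of the module glued
from `T`.
-/

noncomputable section

namespace DifferenceModules

/-! ### Taylor expansions -/

section Taylor

variable (p : ℂ)

/-- The coordinate `π = z - p`, as a polynomial. -/
abbrev coord : ℂ[X] := Polynomial.X - Polynomial.C p

lemma expand_coord : algebraMap ℂ[X] (Disk p) (coord p) = (PowerSeries.X : PowerSeries ℂ) := by
  rw [expand_eq, map_sub, Polynomial.taylor_X, Polynomial.taylor_C, add_sub_cancel_right,
    Polynomial.coe_X]

/-- The value at `p` of a formal function. -/
def diskEval : Disk p →+* ℂ := PowerSeries.constantCoeff (R := ℂ)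

lemma diskEval_algebraMap (f : ℂ[X]) : diskEval p (algebraMap ℂ[X] (Disk p) f) = f.eval p := by
  change PowerSeries.constantCoeff (R := ℂ) ((Polynomial.taylor p f : ℂ[X]) : PowerSeries ℂ) = _
  rw [← PowerSeries.coeff_zero_eq_constantCoeff_apply, Polynomial.coeff_coe,
    Polynomial.taylor_coeff_zero]

/-- Every formal function at `p` agrees with a polynomial to any given order. -/
lemma exists_eq_poly_add (c : Disk p) (k : ℕ) : ∃ (f : ℂ[X]) (b : Disk p),
    c = algebraMap ℂ[X] (Disk p) f + algebraMap ℂ[X] (Disk p) (coord p ^ k) * b := by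
  refine ⟨Polynomial.taylor (-p) (PowerSeries.trunc k c),
    PowerSeries.mk fun i => PowerSeries.coeff (i + k) c, ?_⟩
  rw [map_pow, expand_coord, expand_eq, Polynomial.taylor_taylor, add_neg_cancel,
    Polynomial.taylor_zero]
  exact (PowerSeries.eq_X_pow_mul_shift_add_trunc k c).trans (add_comm _ _)

lemma exists_eq_coord_pow_mul {a : Disk p} (ha : a ≠ 0) : ∃ (k : ℕ) (v : Disk p),
    IsUnit v ∧ a = algebraMap ℂ[X] (Disk p) (coord p ^ k) * v := by
  refine ⟨(PowerSeries.order a).toNat, PowerSeries.divXPowOrder a, ?_, ?_⟩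
  · exact ⟨PowerSeries.Unit_of_divided_by_X_pow_order a,
      PowerSeries.Unit_of_divided_by_X_pow_order_nonzero ha⟩
  · rw [map_pow, expand_coord]
    exact PowerSeries.X_pow_order_mul_divXPowOrder.symm

variable {p}

/-- A nonzero formal function acts on a module like a power of `π`, up to a unit. -/
lemma exists_coord_pow_smul_mem {V : Type*} [AddCommGroup V] [Module (Disk p) V]
    {N : Submodule (Disk p) V} {a : Disk p} (ha : a ≠ 0) {x : V} (h : a • x ∈ N) :
    ∃ k : ℕ, algebraMap ℂ[X] (Disk p) (coord p ^ k) • x ∈ N := by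
  obtain ⟨k, v, hv, rfl⟩ := exists_eq_coord_pow_mul p ha
  refine ⟨k, ?_⟩
  rw [mul_comm, mul_smul] at h
  exact (Submodule.smul_mem_iff_of_isUnit _ hv).1 h

variable {M : Type u} [AddCommGroup M] [Module ℂ[X] M]

lemma smul_of_coord_smul_eq_zero {m : M} (hm : coord p • m = 0) (f : ℂ[X]) :
    f • m = Polynomial.C (f.eval p) • m := by
  obtain ⟨g, hg⟩ := Polynomial.X_sub_C_dvd_sub_C_eval (a := p) (p := f)
  have : (f - Polynomial.C (f.eval p)) • m = 0 := by
    rw [hg, mul_comm, mul_smul, hm, smul_zero]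
  rwa [sub_smul, sub_eq_zero] at this

/-- The elements of `ℂ⟦π⟧ ⊗ M` annihilated by `π` come from `M`. -/
lemma exists_of_coord_smul_eq_zero {x : Disk p ⊗[ℂ[X]] M} (hx : coord p • x = 0) :
    ∃ m : M, coord p • m = 0 ∧ x = 1 ⊗ₜ m := by
  have := IsLocal.flat p (E := Disk p)
  let μ : M →ₗ[ℂ[X]] M := LinearMap.lsmul ℂ[X] M (coord p)
  have hexact := Module.Flat.lTensor_exact (Disk p) (LinearMap.exact_subtype_ker_map μ)
  have hμ : μ.lTensor (Disk p) x = 0 := by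
    rw [← hx]
    clear hx
    induction x using TensorProduct.induction_on with
    | zero => simp
    | add x y hx hy => rw [map_add, hx, hy, smul_add]
    | tmul c m => exact TensorProduct.tmul_smul _ _ _
  obtain ⟨y, rfl⟩ := (hexact x).1 hμ
  clear hx hμ
  induction y using TensorProduct.induction_on with
  | zero => exact ⟨0, by simp, by simp⟩
  | add x y hx hy =>
    obtain ⟨m, hm, hx⟩ := hx
    obtain ⟨n, hn, hy⟩ := hy
    exact ⟨m + n, by rw [smul_add, hm, hn, add_zero], by
      rw [map_add, hx, hy, TensorProduct.tmul_add]⟩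
  | tmul c m =>
    obtain ⟨m, hm⟩ := m
    have hm : coord p • m = 0 := hm
    obtain ⟨f, b, rfl⟩ := exists_eq_poly_add p c 1
    refine ⟨f • m, by rw [smul_comm, hm, smul_zero], ?_⟩
    rw [LinearMap.lTensor_tmul, Submodule.subtype_apply, TensorProduct.add_tmul, pow_one,
      ← Algebra.smul_def, TensorProduct.smul_tmul, hm, TensorProduct.tmul_zero, add_zero,
      Algebra.algebraMap_eq_smul_one, TensorProduct.smul_tmul]

/-- An element of `M` annihilated by `π` is detected by its image in `ℂ⟦π⟧ ⊗ M`. -/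
lemma eq_zero_of_one_tmul_eq_zero {m : M} (hm : coord p • m = 0)
    (h : (1 : Disk p) ⊗ₜ[ℂ[X]] m = 0) : m = 0 := by
  have := IsLocal.flat p (E := Disk p)
  let N : Submodule ℂ[X] M := LinearMap.ker (LinearMap.lsmul ℂ[X] M (coord p))
  have hinj : Function.Injective (N.subtype.lTensor (Disk p)) :=
    Module.Flat.lTensor_preserves_injective_linearMap _ N.subtype_injective
  -- Since `π` kills `N`, evaluation at `p` makes `c ⊗ n ↦ c(p) n` well defined on `ℂ⟦π⟧ ⊗ N`.
  let ev : Disk p ⊗[ℂ[X]] N →+ N := TensorProduct.liftAddHom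
    { toFun := fun c => DistribSMul.toAddMonoidHom N (Polynomial.C (diskEval p c))
      map_zero' := by
        ext n
        simp
      map_add' := fun c d => AddMonoidHom.ext fun n => by
        change Polynomial.C (diskEval p (c + d)) • n =
          Polynomial.C (diskEval p c) • n + Polynomial.C (diskEval p d) • n
        rw [map_add, map_add, add_smul] }
    fun f c n => by
      change Polynomial.C (diskEval p (f • c)) • n = Polynomial.C (diskEval p c) • (f • n)
      have hn : coord p • n = 0 := Subtype.ext n.2
      have hf := smul_of_coord_smul_eq_zero (M := N) hn f
      rw [hf, ← mul_smul, ← map_mul, Algebra.smul_def, map_mul, diskEval_algebraMap, mul_comm]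
  have h0 : (1 : Disk p) ⊗ₜ[ℂ[X]] (⟨m, hm⟩ : N) = 0 := hinj (by rw [map_zero]; exact h)
  have h1 : ev ((1 : Disk p) ⊗ₜ[ℂ[X]] (⟨m, hm⟩ : N)) = ⟨m, hm⟩ := by
    change Polynomial.C (diskEval p 1) • (⟨m, hm⟩ : N) = _
    rw [map_one, map_one, one_smul]
  rw [h0, map_zero] at h1
  exact (congrArg Subtype.val h1).symm

end Taylor

/-! ### Submodules supported on the orbit of `p` -/

section Orbit

variable {p : ℂ}

lemma coord_pow_mem (k : ℕ) : coord p ^ k ∈ orbitMonoid p :=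
  pow_mem (Submonoid.subset_closure (Set.mem_range.2 ⟨0, by simp [coord]⟩)) k

lemma tpow_smul_coord (n : ℤ) (q : ℂ) : tpow n • coord q = coord (q + n) := by
  rw [tpow_smul]
  simp only [coord, Polynomial.sub_comp, Polynomial.X_comp, Polynomial.C_comp, map_add]
  ring

/-- A stable set of elements supported on the orbit `p + ℤ` vanishes if it has no nonzero element
annihilated by `z - p`: translations move any point of the orbit to `p`. -/
lemma eq_zero_of_orbit_torsion {A : Type} [CommRing A] [MulSemiringAction Translations A]
    [Algebra ℂ[X] A] [IsLine A] {M : ModuleCat.{u} (DiffOp A)}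
    (H : Submodule (DiffOp A) (Und M))
    (hπ : ∀ h ∈ H, coord p • h = 0 → h = 0) {h : Und M} (hh : h ∈ H)
    (ht : ∃ s ∈ orbitMonoid p, s • h = 0) : h = 0 := by
  obtain ⟨s, hs, h0⟩ := ht
  induction hs using Submonoid.closure_induction generalizing h with
  | mem s hs =>
    obtain ⟨i, rfl⟩ := hs
    have h1 := tau_smul_poly (-i) (coord (p + i)) h
    have h0 : coord (p + i) • h = 0 := h0
    rw [h0, smul_zero, tpow_smul_coord] at h1
    have h2 : coord p • (tau A (-i) • h) = 0 := by
      rw [h1]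
      simp
    have h3 := hπ _ (H.smul_mem _ hh) h2
    rw [← tau_zero_smul h, ← add_neg_cancel i, ← tau_tau, h3, smul_zero]
  | one => rwa [one_smul] at h0
  | mul s t hs ht ihs iht =>
    rw [mul_smul] at h0
    refine iht hh (ihs ?_ h0)
    rw [und_smul_def]
    exact H.smul_mem _ hh

end Orbit

/-! ### Formal fibres of difference modules -/

section Line

variable {p : ℂ} {A : Type} [CommRing A] [MulSemiringAction Translations A] [Algebra ℂ[X] A]
  [IsLine A] {E : Type} [CommRing E] [Algebra ℂ[X] E] [Algebra (Disk p) E]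
  [IsScalarTower ℂ[X] (Disk p) E] {M N : ModuleCat.{u} (DiffOp A)}

/-- Near an end of `ℤ`, the translates of an element lie in the lattice at that end. -/
lemma eventually_tmul_mem_endLattice (hM : IsHolonomic A M) {l : Filter ℤ} (hl : IsEnd l)
    (v : Und M) : ∀ᶠ n in l, (1 : E) ⊗ₜ[ℂ[X]] (tau A n • v) ∈ endLattice p E l M := by
  obtain ⟨L, hL, -⟩ := exists_coherent hM
  have hL' : L ⊔ Submodule.span ℂ[X] {v} ∈ coherentSubmodules M :=
    coherent_mono hL le_sup_left (hL.1.sup (Submodule.fg_span_singleton v))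
  filter_upwards [endLattice_eq (p := p) (E := E) hl hL'] with n hn
  rw [← hn]
  exact Submodule.subset_span ⟨_, ⟨v, Submodule.mem_sup_right
    (Submodule.mem_span_singleton_self v), rfl⟩, rfl⟩

/-- An additive map commuting with the functions and with the translations is linear over the
difference operators. -/
def homOfEquivariant (f : Und M →+ Und N) (hf : ∀ (a : A) (v : Und M), f (a • v) = a • f v)
    (hτ : ∀ (n : ℤ) (v : Und M), f (tau A n • v) = tau A n • f v) : M ⟶ N :=
  have key : ∀ (d : DiffOp A) (v : Und M), f (d • v) = d • f v := fun d v => by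
    rw [smul_eq_sum d v, smul_eq_sum d (f v), map_sum]
    exact Finset.sum_congr rfl fun g _ => by rw [hf, hτ]
  ModuleCat.ofHom (X := Und M) (Y := Und N)
    { toFun := f
      map_add' := map_add f
      map_smul' := key }

end Line

section Punctured

variable {p : ℂ} {W : ModuleCat.{u} (DiffOp (PuncturedLine p))}

lemma smul_bijective_of_mem_orbitMonoid {s : ℂ[X]} (hs : s ∈ orbitMonoid p) :
    Function.Bijective fun w : Und W => s • w := by
  have hu : IsUnit (algebraMap ℂ[X] (PuncturedLine p) s) :=
    IsLocalization.map_units (PuncturedLine p) (⟨s, hs⟩ : orbitMonoid p)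
  have : (fun w : Und W => s • w) = fun w => hu.unit • w := by
    ext w
    rw [← algebraMap_smul (PuncturedLine p) s w]
    rfl
  rw [this]
  exact MulAction.bijective (β := Und W) hu.unit

lemma eq_zero_of_mem_orbitMonoid {s : ℂ[X]} (hs : s ∈ orbitMonoid p) {w : Und W}
    (h : s • w = 0) : w = 0 :=
  (smul_bijective_of_mem_orbitMonoid hs).1 (by simpa using h)

/-- Weak approximation: modulo a submodule with torsion quotient, every element of the fibre at
the punctured formal disk comes from a global element. Indeed, as `π` is invertible on `W`, only the
approximation of formal functions by polynomials is needed. -/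
lemma exists_one_tmul_add (N : Submodule (Disk p) (PuncturedDisk p ⊗[ℂ[X]] Und W))
    (hN : ∀ x, ∃ a : Disk p, a ≠ 0 ∧ a • x ∈ N) (x : PuncturedDisk p ⊗[ℂ[X]] Und W) :
    ∃ w : Und W, ∃ y ∈ N, x = (1 : PuncturedDisk p) ⊗ₜ[ℂ[X]] w + y := by
  induction x using TensorProduct.induction_on with
  | zero => exact ⟨0, 0, zero_mem _, by simp⟩
  | add x x' hx hx' =>
    obtain ⟨w, y, hy, rfl⟩ := hx
    obtain ⟨w', y', hy', rfl⟩ := hx'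
    exact ⟨w + w', y + y', add_mem hy hy', by rw [TensorProduct.tmul_add]; abel⟩
  | tmul c w =>
    obtain ⟨b, hb, a, hab⟩ := IsLocal.denom (p := p) c
    obtain ⟨k, a, hk⟩ := exists_coord_pow_smul_mem
      (N := LinearMap.range (Algebra.linearMap (Disk p) (PuncturedDisk p))) hb ⟨a, hab.symm⟩
    obtain ⟨a', ha', h⟩ := hN ((1 : PuncturedDisk p) ⊗ₜ[ℂ[X]] w)
    obtain ⟨j, hj⟩ := exists_coord_pow_smul_mem ha' h
    obtain ⟨w', rfl⟩ := (smul_bijective_of_mem_orbitMonoid (W := W) (coord_pow_mem (p := p) k)).2 w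
    obtain ⟨f, b, rfl⟩ := exists_eq_poly_add p a (k + j)
    refine ⟨f • w', b • (algebraMap ℂ[X] (Disk p) (coord p ^ j) •
      ((1 : PuncturedDisk p) ⊗ₜ[ℂ[X]] (coord p ^ k • w'))), N.smul_mem _ hj, ?_⟩
    rw [Algebra.linearMap_apply, algebraMap_smul] at hk
    change c ⊗ₜ[ℂ[X]] (coord p ^ k • w') = _
    rw [← TensorProduct.smul_tmul, ← hk, Algebra.algebraMap_eq_smul_one, add_smul,
      TensorProduct.add_tmul, algebraMap_smul, TensorProduct.smul_tmul, ← TensorProduct.smul_tmul',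
      TensorProduct.tmul_smul (coord p ^ k), ← algebraMap_smul (Disk p) (coord p ^ k)
        ((1 : PuncturedDisk p) ⊗ₜ[ℂ[X]] w'), ← mul_smul, ← mul_smul, pow_add, map_mul]
    congr 2
    ring

end Punctured

/-! ### Products over the orbit -/

section OrbitProduct

/-- The product of copies of `V` placed at the points `p - n`, for `n : ℤ`. The `n`-th component
of the family attached to a section `m` of a difference module is the expansion of `τⁿ m` at `p`. -/
def OrbitProduct (p : ℂ) (V : Type u) [AddCommGroup V] [Module (Disk p) V] : Type u := ℤ → V

variable {p : ℂ} {V : Type u} [AddCommGroup V] [Module (Disk p) V]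

instance : AddCommGroup (OrbitProduct p V) := inferInstanceAs (AddCommGroup (ℤ → V))

@[ext]
lemma OrbitProduct.ext {v w : OrbitProduct p V} (h : ∀ n, v n = w n) : v = w := funext h

@[simp] lemma OrbitProduct.add_apply (v w : OrbitProduct p V) (n : ℤ) :
    (v + w) n = v n + w n := rfl

@[simp] lemma OrbitProduct.zero_apply (n : ℤ) : (0 : OrbitProduct p V) n = 0 := rfl

instance OrbitProduct.instPolynomialModule : Module ℂ[X] (OrbitProduct p V) where
  smul f v := fun n => algebraMap ℂ[X] (Disk p) (tpow n • f) • v n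
  one_smul v := by
    ext n
    change algebraMap ℂ[X] (Disk p) (tpow n • 1) • v n = v n
    rw [smul_one, map_one, one_smul]
  mul_smul f g v := by
    ext n
    change algebraMap ℂ[X] (Disk p) (tpow n • (f * g)) • v n = algebraMap ℂ[X] (Disk p) _ •
      (algebraMap ℂ[X] (Disk p) _ • v n)
    rw [smul_mul', map_mul, mul_smul]
  smul_zero f := by
    ext n
    exact smul_zero _
  smul_add f v w := by
    ext n
    exact smul_add _ _ _
  add_smul f g v := by
    ext n
    change algebraMap ℂ[X] (Disk p) (tpow n • (f + g)) • v n = algebraMap ℂ[X] (Disk p) _ • v n +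
      algebraMap ℂ[X] (Disk p) _ • v n
    rw [smul_add, map_add, add_smul]
  zero_smul v := by
    ext n
    change algebraMap ℂ[X] (Disk p) (tpow n • 0) • v n = 0
    rw [smul_zero, map_zero, zero_smul]

variable (p V) in
/-- Translations permute the components. -/
def OrbitProduct.shift : Translations →* AddMonoid.End (OrbitProduct p V) where
  toFun g :=
    { toFun := fun v n => v (n + Multiplicative.toAdd g)
      map_zero' := rfl
      map_add' := fun _ _ => rfl }
  map_one' := by
    ext v n
    change v (n + 0) = v n
    rw [add_zero]
  map_mul' g h := by
    ext v n
    change v (n + (Multiplicative.toAdd g + Multiplicative.toAdd h)) =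
      v (n + Multiplicative.toAdd g + Multiplicative.toAdd h)
    rw [add_assoc]

variable (p V) in
/-- The action of the difference operators on the product over the orbit. -/
def OrbitProduct.diffOpToEnd : DiffOp ℂ[X] →+* AddMonoid.End (OrbitProduct p V) :=
  SkewMonoidAlgebra.liftNCRingHom (Module.toAddMonoidEnd ℂ[X] (OrbitProduct p V)) (shift p V)
    fun {f g} => by
      refine AddMonoidHom.ext fun v => funext fun n => ?_
      change algebraMap ℂ[X] (Disk p) (tpow n • g • f) • v (n + Multiplicative.toAdd g) =
        algebraMap ℂ[X] (Disk p) (tpow (n + Multiplicative.toAdd g) • f) •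
          v (n + Multiplicative.toAdd g)
      congr 2
      rw [← mul_smul]
      rfl

instance OrbitProduct.instModule : Module (DiffOp ℂ[X]) (OrbitProduct p V) :=
  Module.compHom _ (OrbitProduct.diffOpToEnd p V)

lemma OrbitProduct.single_smul (g : Translations) (f : ℂ[X]) (v : OrbitProduct p V) (n : ℤ) :
    ((SkewMonoidAlgebra.single g f : DiffOp ℂ[X]) • v) n =
      algebraMap ℂ[X] (Disk p) (tpow n • f) • v (n + Multiplicative.toAdd g) := by
  have h : OrbitProduct.diffOpToEnd p V (SkewMonoidAlgebra.single g f) =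
      Module.toAddMonoidEnd ℂ[X] (OrbitProduct p V) f * OrbitProduct.shift p V g :=
    SkewMonoidAlgebra.liftNC_single _ _ _ _
  exact congrFun (DFunLike.congr_fun h v) n

end OrbitProduct

/-! ### Glued modules -/

/-- A difference module on the punctured line acts through its restriction of scalars as a module
over the difference operators on the line. -/
instance instModuleExtendOp {p : ℂ} (W : ModuleCat.{u} (DiffOp (PuncturedLine p))) :
    Module (DiffOp ℂ[X]) (Und W) := Module.compHom (Und W) (extendOp p)

/-- A holonomic difference module `W` on the punctured line, a `ℂ⟦π⟧`-module `V` with a left and a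
right submodule, and an identification of `ℂ⸨π⸩ ⊗ V` with the fibre of `W` that matches the left
and right submodules. The identification is given by the map `V → ℂ⸨π⸩ ⊗ W` it induces. -/
structure Gluing (p : ℂ) (W : ModuleCat.{u} (DiffOp (PuncturedLine p))) (V : Type u)
    [AddCommGroup V] [Module (Disk p) V] where
  holonomic : IsHolonomic (PuncturedLine p) W
  /-- the map from `V` to the fibre of `W` at the punctured formal disk -/
  map : V →ₗ[Disk p] PuncturedDisk p ⊗[ℂ[X]] Und W
  isLocalizedModule : IsLocalizedModule (nonZeroDivisors (Disk p)) map
  /-- the submodule `Vˡ` -/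
  left : Submodule (Disk p) V
  /-- the submodule `Vʳ` -/
  right : Submodule (Disk p) V
  map_left : left.map map = endLattice p (PuncturedDisk p) atTop W
  map_right : right.map map = endLattice p (PuncturedDisk p) atBot W
  eq_zero_left : ∀ v ∈ left, map v = 0 → v = 0
  eq_zero_right : ∀ v ∈ right, map v = 0 → v = 0

namespace Gluing

variable {p : ℂ} {W : ModuleCat.{u} (DiffOp (PuncturedLine p))} {V : Type u}
  [AddCommGroup V] [Module (Disk p) V] (D : Gluing p W V)

lemma tmul_tau_smul (n : ℤ) (f : ℂ[X]) (w : Und W) :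
    (1 : PuncturedDisk p) ⊗ₜ[ℂ[X]] (tau (PuncturedLine p) n • (f • w)) =
      algebraMap ℂ[X] (Disk p) (tpow n • f) •
        ((1 : PuncturedDisk p) ⊗ₜ[ℂ[X]] (tau (PuncturedLine p) n • w)) := by
  rw [tau_smul_poly, TensorProduct.tmul_smul, algebraMap_smul]

lemma extendOp_single_smul (g : Translations) (f : ℂ[X]) (w : Und W) :
    (SkewMonoidAlgebra.single g f : DiffOp ℂ[X]) • w =
      f • (tau (PuncturedLine p) (Multiplicative.toAdd g) • w) := by
  change extendOp p _ • w = _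
  rw [extendOp_single, und_smul_def, ← mul_smul]
  congr 1
  change _ = SkewMonoidAlgebra.single _ _ * SkewMonoidAlgebra.single _ _
  simp [SkewMonoidAlgebra.single_mul_single, tpow]

lemma eventually_add {l : Filter ℤ} (hl : IsEnd l) {P : ℤ → Prop} (h : ∀ᶠ n in l, P n) (k : ℤ) :
    ∀ᶠ n in l, P (n + k) := by
  rcases hl with rfl | rfl
  · exact (tendsto_atTop_add_const_right atTop k tendsto_id).eventually h
  · exact (tendsto_atBot_add_const_right atBot k tendsto_id).eventually h

/-- The families consisting of an element `w` of `W` and of lifts to `V` of the expansions of `w`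
along the orbit of `p`, which are eventually in the left and in the right submodule. -/
def families : Submodule (DiffOp ℂ[X]) (Und W × OrbitProduct p V) where
  carrier := {x | (∀ n, D.map (x.2 n) =
      (1 : PuncturedDisk p) ⊗ₜ[ℂ[X]] (tau (PuncturedLine p) n • x.1)) ∧
    (∀ᶠ n in atTop, x.2 n ∈ D.left) ∧ ∀ᶠ n in atBot, x.2 n ∈ D.right}
  zero_mem' := ⟨fun n => by simp, by simp, by simp⟩
  add_mem' := by
    rintro x y ⟨hx, hxl, hxr⟩ ⟨hy, hyl, hyr⟩
    refine ⟨fun n => ?_, ?_, ?_⟩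
    · simp only [Prod.fst_add, Prod.snd_add, OrbitProduct.add_apply, map_add, hx, hy, smul_add,
        TensorProduct.tmul_add]
    · filter_upwards [hxl, hyl] with n h h' using add_mem h h'
    · filter_upwards [hxr, hyr] with n h h' using add_mem h h'
  smul_mem' := by
    intro d x hx
    induction d using SkewMonoidAlgebra.induction_on with
    | zero =>
      rw [zero_smul]
      exact ⟨fun n => by simp, by simp, by simp⟩
    | add d e hd he =>
      rw [add_smul]
      obtain ⟨hx, hxl, hxr⟩ := hd
      obtain ⟨hy, hyl, hyr⟩ := he
      refine ⟨fun n => ?_, ?_, ?_⟩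
      · rw [Prod.fst_add, Prod.snd_add, OrbitProduct.add_apply, map_add, hx, hy, smul_add,
          TensorProduct.tmul_add]
      · filter_upwards [hxl, hyl] with n h h' using add_mem h h'
      · filter_upwards [hxr, hyr] with n h h' using add_mem h h'
    | single g f =>
      obtain ⟨hx, hxl, hxr⟩ := hx
      refine ⟨fun n => ?_, ?_, ?_⟩
      · rw [Prod.smul_fst, Prod.smul_snd, extendOp_single_smul, OrbitProduct.single_smul, map_smul,
          hx, tmul_tau_smul, tau_tau]
      · filter_upwards [eventually_add (Or.inl rfl) hxl (Multiplicative.toAdd g)] with n h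
        rw [Prod.smul_snd, OrbitProduct.single_smul]
        exact D.left.smul_mem _ h
      · filter_upwards [eventually_add (Or.inr rfl) hxr (Multiplicative.toAdd g)] with n h
        rw [Prod.smul_snd, OrbitProduct.single_smul]
        exact D.right.smul_mem _ h

/-- The difference module on the line obtained by gluing. -/
def glued : ModuleCat.{u} (DiffOp ℂ[X]) := ModuleCat.of (DiffOp ℂ[X]) D.families

/-- The component in `W` of a section of the glued module. -/
def toW : Und D.glued →ₗ[ℂ[X]] Und W where
  toFun x := (show D.families from x).1.1
  map_add' _ _ := rfl
  map_smul' f x := by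
    refine (extendOp_single_smul 1 f _).trans ?_
    rw [toAdd_one, tau_zero_smul]
    rfl

/-- The expansion at `p` of a translate `τⁿ m` of a section `m` of the glued module. -/
def toV (n : ℤ) : Und D.glued →+ V where
  toFun x := (show D.families from x).1.2 n
  map_zero' := rfl
  map_add' _ _ := rfl

variable {D}

lemma glued_ext {x y : Und D.glued} (h : D.toW x = D.toW y) (h' : ∀ n, D.toV n x = D.toV n y) :
    x = y := Subtype.ext (Prod.ext h (funext h'))

lemma map_toV (n : ℤ) (x : Und D.glued) :
    D.map (D.toV n x) = (1 : PuncturedDisk p) ⊗ₜ[ℂ[X]] (tau (PuncturedLine p) n • D.toW x) :=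
  (show D.families from x).2.1 n

lemma eventually_toV_left (x : Und D.glued) : ∀ᶠ n in atTop, D.toV n x ∈ D.left :=
  (show D.families from x).2.2.1

lemma eventually_toV_right (x : Und D.glued) : ∀ᶠ n in atBot, D.toV n x ∈ D.right :=
  (show D.families from x).2.2.2

lemma exists_glued (w : Und W) (v : ℤ → V)
    (h : ∀ n, D.map (v n) = (1 : PuncturedDisk p) ⊗ₜ[ℂ[X]] (tau (PuncturedLine p) n • w))
    (hl : ∀ᶠ n in atTop, v n ∈ D.left) (hr : ∀ᶠ n in atBot, v n ∈ D.right) :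
    ∃ x : Und D.glued, D.toW x = w ∧ ∀ n, D.toV n x = v n :=
  ⟨(⟨(w, v), h, hl, hr⟩ : D.families), rfl, fun _ => rfl⟩

lemma toW_smul (d : DiffOp ℂ[X]) (x : Und D.glued) : D.toW (d • x) = extendOp p d • D.toW x := rfl

lemma toW_tau (n : ℤ) (x : Und D.glued) :
    D.toW (tau ℂ[X] n • x) = tau (PuncturedLine p) n • D.toW x := by
  refine (extendOp_single_smul (tpow n) 1 _).trans ?_
  rw [one_smul]
  rfl

lemma toV_smul (n : ℤ) (f : ℂ[X]) (x : Und D.glued) :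
    D.toV n (f • x) = algebraMap ℂ[X] (Disk p) (tpow n • f) • D.toV n x := by
  refine (OrbitProduct.single_smul 1 f _ n).trans ?_
  rw [toAdd_one, add_zero]
  rfl

lemma toV_tau (n k : ℤ) (x : Und D.glued) : D.toV n (tau ℂ[X] k • x) = D.toV (n + k) x := by
  refine (OrbitProduct.single_smul (tpow k) 1 _ n).trans ?_
  rw [smul_one, map_one, one_smul]
  rfl

end Gluing

namespace Gluing

/-! ### The glued module on the punctured line -/

variable {p : ℂ} {W : ModuleCat.{u} (DiffOp (PuncturedLine p))} {V : Type u}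
  [AddCommGroup V] [Module (Disk p) V] {D : Gluing p W V}

/-- There are functions with prescribed orders of vanishing at finitely many points of the orbit,
and no other zeros. -/
lemma exists_orbit_function (T : Finset ℤ) (k : ℤ → ℕ) : ∃ s ∈ orbitMonoid p,
    (0 ∉ T → s.eval p ≠ 0) ∧ ∀ n ∈ T, coord p ^ k n ∣ tpow n • s := by
  refine ⟨∏ n ∈ T, coord (p - n) ^ k n, ?_, fun h0 => ?_, fun n hn => ?_⟩
  · refine Submonoid.prod_mem _ fun n _ => pow_mem (Submonoid.subset_closure ?_) _
    exact Set.mem_range.2 ⟨-n, by simp [coord, sub_eq_add_neg]⟩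
  · rw [Polynomial.eval_prod]
    refine Finset.prod_ne_zero_iff.2 fun n hn => ?_
    have : (n : ℂ) ≠ 0 := by
      rintro e
      exact h0 (by rwa [Int.cast_eq_zero.1 e] at hn)
    simp [coord, this]
  · have h1 : tpow n • (coord (p - n) ^ k n) = coord p ^ k n := by
      rw [smul_pow', tpow_smul_coord, sub_add_cancel]
    rw [← h1]
    exact map_dvd (MulSemiringAction.toRingHom Translations ℂ[X] (tpow n))
      (Finset.dvd_prod_of_mem (fun n : ℤ => coord (p - n) ^ k n) hn)

lemma finite_of_ends {P : ℤ → Prop} (h : ∀ᶠ n in atTop, P n) (h' : ∀ᶠ n in atBot, P n) :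
    {n | ¬ P n}.Finite := by
  have : ∀ᶠ n in cofinite, P n := by
    rw [Int.cofinite_eq]
    exact ⟨h', h⟩
  exact this

variable (D) in
lemma exists_smul_mem_range (x : PuncturedDisk p ⊗[ℂ[X]] Und W) :
    ∃ a : Disk p, a ≠ 0 ∧ a • x ∈ LinearMap.range D.map := by
  have := D.isLocalizedModule
  obtain ⟨⟨v, a⟩, h⟩ := IsLocalizedModule.surj (nonZeroDivisors (Disk p)) D.map x
  exact ⟨a, nonZeroDivisors.coe_ne_zero a, v, h.symm⟩

lemma exists_smul_eq_zero {v : V} (hv : D.map v = 0) : ∃ a : Disk p, a ≠ 0 ∧ a • v = 0 := by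
  have := D.isLocalizedModule
  obtain ⟨a, h⟩ := (IsLocalizedModule.eq_zero_iff (nonZeroDivisors (Disk p)) D.map).1 hv
  exact ⟨a, nonZeroDivisors.coe_ne_zero a, h⟩

variable (D) in
lemma eventually_exists_left (w : Und W) : ∀ᶠ n : ℤ in atTop, ∃ v ∈ D.left,
    D.map v = (1 : PuncturedDisk p) ⊗ₜ[ℂ[X]] (tau (PuncturedLine p) n • w) := by
  filter_upwards [eventually_tmul_mem_endLattice (p := p) (E := PuncturedDisk p) D.holonomic
    (Or.inl rfl) w] with n hn
  rwa [← D.map_left] at hn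

variable (D) in
lemma eventually_exists_right (w : Und W) : ∀ᶠ n : ℤ in atBot, ∃ v ∈ D.right,
    D.map v = (1 : PuncturedDisk p) ⊗ₜ[ℂ[X]] (tau (PuncturedLine p) n • w) := by
  filter_upwards [eventually_tmul_mem_endLattice (p := p) (E := PuncturedDisk p) D.holonomic
    (Or.inr rfl) w] with n hn
  rwa [← D.map_right] at hn

/-- An element of `W` extends to the glued module if its expansions along the orbit are in the
image of `V`: the conditions near the ends can be met automatically. -/
lemma exists_toW_eq {w : Und W} (h : ∀ n, (1 : PuncturedDisk p) ⊗ₜ[ℂ[X]]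
    (tau (PuncturedLine p) n • w) ∈ LinearMap.range D.map) : ∃ x : Und D.glued, D.toW x = w := by
  have hl := D.eventually_exists_left w
  have hr := D.eventually_exists_right w
  -- At `n`, a lift in the submodule at the nearer end is preferred, if there is one.
  have key : ∀ n : ℤ, ∃ v, D.map v =
      (1 : PuncturedDisk p) ⊗ₜ[ℂ[X]] (tau (PuncturedLine p) n • w) ∧
      (0 ≤ n → (∃ v ∈ D.left, D.map v =
        (1 : PuncturedDisk p) ⊗ₜ[ℂ[X]] (tau (PuncturedLine p) n • w)) → v ∈ D.left) ∧
      (n < 0 → (∃ v ∈ D.right, D.map v =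
        (1 : PuncturedDisk p) ⊗ₜ[ℂ[X]] (tau (PuncturedLine p) n • w)) → v ∈ D.right) := by
    intro n
    obtain ⟨v₀, h₀⟩ := h n
    rcases le_or_gt 0 n with hn | hn
    · by_cases H : ∃ v ∈ D.left, D.map v =
          (1 : PuncturedDisk p) ⊗ₜ[ℂ[X]] (tau (PuncturedLine p) n • w)
      · obtain ⟨v, hv, e⟩ := H
        exact ⟨v, e, fun _ _ => hv, fun h => absurd hn h.not_ge⟩
      · exact ⟨v₀, h₀, fun _ h => absurd h H, fun h => absurd hn h.not_ge⟩
    · by_cases H : ∃ v ∈ D.right, D.map v =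
          (1 : PuncturedDisk p) ⊗ₜ[ℂ[X]] (tau (PuncturedLine p) n • w)
      · obtain ⟨v, hv, e⟩ := H
        exact ⟨v, e, fun h => absurd hn h.not_gt, fun _ _ => hv⟩
      · exact ⟨v₀, h₀, fun h => absurd hn h.not_gt, fun _ h => absurd h H⟩
  choose v hv hvl hvr using key
  obtain ⟨x, hx, -⟩ := exists_glued w v hv
    (by filter_upwards [hl, eventually_ge_atTop 0] with n h1 h2 using hvl n h2 h1)
    (by filter_upwards [hr, eventually_lt_atBot 0] with n h1 h2 using hvr n h2 h1)
  exact ⟨x, hx⟩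

variable (D) in
/-- Every element of `W` extends to the glued module after multiplication by a function with zeros
on the orbit; no zero at `p` is needed if the expansion at `p` is in the image of `V`. -/
lemma exists_toW_eq_smul (w : Und W) : ∃ s ∈ orbitMonoid p,
    ((1 : PuncturedDisk p) ⊗ₜ[ℂ[X]] w ∈ LinearMap.range D.map → s.eval p ≠ 0) ∧
    ∃ x : Und D.glued, D.toW x = s • w := by
  have hT : {n : ℤ | ¬ (1 : PuncturedDisk p) ⊗ₜ[ℂ[X]] (tau (PuncturedLine p) n • w) ∈
      LinearMap.range D.map}.Finite := by
    refine finite_of_ends ?_ ?_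
    · filter_upwards [D.eventually_exists_left w] with n h
      obtain ⟨v, -, h⟩ := h
      exact ⟨v, h⟩
    · filter_upwards [D.eventually_exists_right w] with n h
      obtain ⟨v, -, h⟩ := h
      exact ⟨v, h⟩
  have hk : ∀ n : ℤ, ∃ k : ℕ, algebraMap ℂ[X] (Disk p) (coord p ^ k) •
      ((1 : PuncturedDisk p) ⊗ₜ[ℂ[X]] (tau (PuncturedLine p) n • w)) ∈ LinearMap.range D.map := by
    intro n
    obtain ⟨a, ha, h⟩ := D.exists_smul_mem_range
      ((1 : PuncturedDisk p) ⊗ₜ[ℂ[X]] (tau (PuncturedLine p) n • w))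
    exact exists_coord_pow_smul_mem ha h
  choose k hk using hk
  obtain ⟨s, hs, hs0, hs'⟩ := exists_orbit_function (p := p) hT.toFinset k
  refine ⟨s, hs, fun h => hs0 ?_, exists_toW_eq fun n => ?_⟩
  · rw [Set.Finite.mem_toFinset]
    intro h'
    exact h' (by rwa [tau_zero_smul])
  · rw [tmul_tau_smul]
    by_cases hn : n ∈ hT.toFinset
    · obtain ⟨t, ht⟩ := hs' n hn
      rw [ht, mul_comm, map_mul, mul_smul]
      exact Submodule.smul_mem _ _ (hk n)
    · rw [Set.Finite.mem_toFinset] at hn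
      exact Submodule.smul_mem _ _ (not_not.1 hn)

/-- A section of the glued module that vanishes on the punctured line is supported at finitely
many points of the orbit, because the submodules at the ends have no torsion. -/
lemma exists_smul_eq_zero_of_toW_eq_zero {x : Und D.glued} (hx : D.toW x = 0) :
    ∃ s ∈ orbitMonoid p, s • x = 0 := by
  have h0 : ∀ n, D.map (D.toV n x) = 0 := fun n => by rw [map_toV, hx, smul_zero,
    TensorProduct.tmul_zero]
  have hT : {n : ℤ | ¬ D.toV n x = 0}.Finite := by
    refine finite_of_ends ?_ ?_
    · filter_upwards [eventually_toV_left x] with n h using D.eq_zero_left _ h (h0 n)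
    · filter_upwards [eventually_toV_right x] with n h using D.eq_zero_right _ h (h0 n)
  have hk : ∀ n : ℤ, ∃ k : ℕ, algebraMap ℂ[X] (Disk p) (coord p ^ k) • D.toV n x = 0 := by
    intro n
    obtain ⟨a, ha, h⟩ := exists_smul_eq_zero (h0 n)
    exact exists_coord_pow_smul_mem (N := ⊥) ha h
  choose k hk using hk
  obtain ⟨s, hs, -, hs'⟩ := exists_orbit_function (p := p) hT.toFinset k
  refine ⟨s, hs, glued_ext ?_ fun n => ?_⟩
  · rw [map_smul, hx, smul_zero, map_zero]
  · rw [toV_smul, map_zero]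
    by_cases hn : n ∈ hT.toFinset
    · obtain ⟨t, ht⟩ := hs' n hn
      rw [ht, mul_comm, map_mul, mul_smul, hk, smul_zero]
    · rw [Set.Finite.mem_toFinset] at hn
      rw [not_not.1 hn, smul_zero]

variable (D) in
lemma isLocalizedModule_toW : IsLocalizedModule (orbitMonoid p) D.toW where
  map_units s := (Module.End.isUnit_iff _).2 (smul_bijective_of_mem_orbitMonoid s.2)
  surj w := by
    obtain ⟨s, hs, -, x, hx⟩ := D.exists_toW_eq_smul w
    exact ⟨(x, ⟨s, hs⟩), hx.symm⟩
  exists_of_eq {x y} h := by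
    rw [← sub_eq_zero, ← map_sub] at h
    obtain ⟨s, hs, h⟩ := exists_smul_eq_zero_of_toW_eq_zero h
    refine ⟨⟨s, hs⟩, ?_⟩
    rw [smul_sub, sub_eq_zero] at h
    exact h

variable (D) in
/-- The restriction of the glued module to the punctured line is `W`. -/
def lineEquiv : PuncturedLine p ⊗[ℂ[X]] Und D.glued ≃ₗ[PuncturedLine p] Und W :=
  have := D.isLocalizedModule_toW
  (IsLocalizedModule.isBaseChange (orbitMonoid p) (PuncturedLine p) D.toW).equiv

lemma lineEquiv_tmul (a : PuncturedLine p) (x : Und D.glued) :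
    D.lineEquiv (a ⊗ₜ x) = a • D.toW x := by
  have := D.isLocalizedModule_toW
  exact (IsLocalizedModule.isBaseChange (orbitMonoid p) (PuncturedLine p) D.toW).equiv_tmul a x

lemma lineEquiv_tau (n : ℤ) (x : PuncturedLine p ⊗[ℂ[X]] Und D.glued) :
    D.lineEquiv (tau (PuncturedLine p) n • x) = tau (PuncturedLine p) n • D.lineEquiv x := by
  induction x using TensorProduct.induction_on with
  | zero => simp
  | add x y hx hy => rw [smul_add, map_add, map_add, smul_add, hx, hy]
  | tmul a x => rw [tau_smul_baseChange, lineEquiv_tmul, lineEquiv_tmul, toW_tau, tau_smul_smul]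

variable (D) in
/-- The restriction of the glued module to the punctured line, as a difference module, is `W`. -/
def lineIso : baseChange (PuncturedLine p) D.glued ≅ W :=
  have key : ∀ (d : DiffOp (PuncturedLine p)) (x : PuncturedLine p ⊗[ℂ[X]] Und D.glued),
      D.lineEquiv (d • x) = d • D.lineEquiv x := fun d x => by
    induction d using SkewMonoidAlgebra.induction_on with
    | zero => rw [zero_smul, zero_smul, map_zero]
    | add d e hd he => rw [add_smul, add_smul, map_add, hd, he]
    | single g a =>
      have h : (SkewMonoidAlgebra.single g a : DiffOp (PuncturedLine p)) =
          coeffHom (PuncturedLine p) a * tau (PuncturedLine p) (Multiplicative.toAdd g) := by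
        change _ = SkewMonoidAlgebra.single _ _ * SkewMonoidAlgebra.single _ _
        simp [SkewMonoidAlgebra.single_mul_single, tpow]
      rw [h, mul_smul, mul_smul, coeffHom_smul_baseChange, map_smul, lineEquiv_tau]
      rfl
  let e : (PuncturedLine p ⊗[ℂ[X]] Und D.glued) ≃ₗ[DiffOp (PuncturedLine p)] Und W :=
    { D.lineEquiv.toAddEquiv with map_smul' := key }
  e.toModuleIso

end Gluing

/-! ### The glued module on the formal disk -/

section Denominators

variable {p : ℂ}

lemma extendOp_coeffHom (f : ℂ[X]) : extendOp p (coeffHom ℂ[X] f) =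
    coeffHom (PuncturedLine p) (algebraMap ℂ[X] (PuncturedLine p) f) := extendOp_single p 1 f

lemma isUnit_coeffHom {s : ℂ[X]} (hs : s ∈ orbitMonoid p) :
    IsUnit (coeffHom (PuncturedLine p) (algebraMap ℂ[X] (PuncturedLine p) s)) :=
  (IsLocalization.map_units (PuncturedLine p) (⟨s, hs⟩ : orbitMonoid p)).map _

/-- Clearing denominators in a difference operator. -/
lemma exists_coeffHom_mul_eq (d : DiffOp (PuncturedLine p)) : ∃ s ∈ orbitMonoid p,
    ∃ e : DiffOp ℂ[X], coeffHom (PuncturedLine p) (algebraMap ℂ[X] (PuncturedLine p) s) * d =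
      extendOp p e := by
  induction d using SkewMonoidAlgebra.induction_on with
  | zero => exact ⟨1, one_mem _, 0, by rw [mul_zero, map_zero]⟩
  | add d d' h h' =>
    obtain ⟨s, hs, e, h⟩ := h
    obtain ⟨s', hs', e', h'⟩ := h'
    refine ⟨s * s', mul_mem hs hs', coeffHom ℂ[X] s' * e + coeffHom ℂ[X] s * e', ?_⟩
    rw [map_add, map_mul (extendOp p), map_mul (extendOp p), extendOp_coeffHom, extendOp_coeffHom,
      ← h, ← h', mul_add, ← mul_assoc, ← mul_assoc, ← map_mul, ← map_mul, ← map_mul, ← map_mul,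
      mul_comm s' s]
  | single g a =>
    obtain ⟨⟨f, s⟩, h⟩ := IsLocalization.surj (orbitMonoid p) a
    refine ⟨s, s.2, SkewMonoidAlgebra.single g f, ?_⟩
    rw [extendOp_single, ← h]
    change SkewMonoidAlgebra.single _ _ * SkewMonoidAlgebra.single _ _ = _
    simp [SkewMonoidAlgebra.single_mul_single, mul_comm]

end Denominators

namespace Gluing

variable {p : ℂ} {W : ModuleCat.{u} (DiffOp (PuncturedLine p))} {V : Type u}
  [AddCommGroup V] [Module (Disk p) V] {D : Gluing p W V}

lemma undMap_lineIso_toBaseChange (x : Und D.glued) :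
    undMap D.lineIso.hom (toBaseChange (PuncturedLine p) D.glued x) = D.toW x :=
  (lineEquiv_tmul 1 x).trans (one_smul _ _)

variable (D) in
/-- The fibre of the glued module at the punctured formal disk is the fibre of `W`. -/
def puncturedEquiv : PuncturedDisk p ⊗[Disk p] (Disk p ⊗[ℂ[X]] Und D.glued) ≃ₗ[Disk p]
    PuncturedDisk p ⊗[ℂ[X]] Und W :=
  (squareEquiv p D.glued).trans <| TensorProduct.AlgebraTensorModule.congr
    (LinearEquiv.refl (Disk p) (PuncturedDisk p))
    (undBaseChange.trans (D.lineEquiv.restrictScalars ℂ[X]))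

variable (D) in
lemma puncturedEquiv_apply (z : PuncturedDisk p ⊗[Disk p] (Disk p ⊗[ℂ[X]] Und D.glued)) :
    D.puncturedEquiv z =
      fibreMap p (PuncturedDisk p) D.lineIso.hom (squareEquiv p D.glued z) := rfl

lemma puncturedEquiv_tmul (k : PuncturedDisk p) (a : Disk p) (x : Und D.glued) :
    D.puncturedEquiv (k ⊗ₜ (a ⊗ₜ x)) = (a • k) ⊗ₜ D.toW x := by
  rw [puncturedEquiv_apply, squareEquiv_tmul]
  change (a • k) ⊗ₜ[ℂ[X]] (undMap D.lineIso.hom (toBaseChange (PuncturedLine p) D.glued x)) = _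
  rw [undMap_lineIso_toBaseChange]

variable [Module ℂ[X] V] [IsScalarTower ℂ[X] (Disk p) V]

variable (D) in
/-- The expansion at `p` of a section of the glued module. -/
def toDisk : Und D.glued →ₗ[ℂ[X]] V where
  toFun := D.toV 0
  map_add' := map_add _
  map_smul' f x := by
    rw [toV_smul, RingHom.id_apply, algebraMap_smul]
    congr 1
    exact one_smul Translations f

variable (D) in
/-- The comparison of the fibre at the formal disk of the glued module with `V`. -/
def diskMap : Disk p ⊗[ℂ[X]] Und D.glued →ₗ[Disk p] V := D.toDisk.liftBaseChange (Disk p)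

lemma diskMap_tmul (a : Disk p) (x : Und D.glued) : D.diskMap (a ⊗ₜ x) = a • D.toV 0 x :=
  LinearMap.liftBaseChange_tmul _ _ _ _

lemma map_diskMap (y : Disk p ⊗[ℂ[X]] Und D.glued) :
    D.map (D.diskMap y) = D.puncturedEquiv (1 ⊗ₜ y) := by
  induction y using TensorProduct.induction_on with
  | zero => simp only [TensorProduct.tmul_zero, map_zero]
  | add x y hx hy => simp only [TensorProduct.tmul_add, map_add, hx, hy]
  | tmul a x =>
    rw [puncturedEquiv_tmul, diskMap_tmul, map_smul, map_toV, tau_zero_smul,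
      TensorProduct.smul_tmul']

lemma mem_range_diskMap_of_map_eq_zero {v : V} (hv : D.map v = 0) :
    v ∈ LinearMap.range D.diskMap := by
  classical
  -- The section with expansion `v` at `p` and zero elsewhere.
  obtain ⟨x, -, hx⟩ := exists_glued (D := D) 0 (Pi.single 0 v)
    (fun n => by
      rw [smul_zero, TensorProduct.tmul_zero]
      rcases eq_or_ne n 0 with rfl | hn
      · rwa [Pi.single_eq_same]
      · rw [Pi.single_eq_of_ne hn, map_zero])
    (by
      filter_upwards [eventually_gt_atTop 0] with n hn
      rw [Pi.single_eq_of_ne hn.ne']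
      exact zero_mem _)
    (by
      filter_upwards [eventually_lt_atBot 0] with n hn
      rw [Pi.single_eq_of_ne hn.ne]
      exact zero_mem _)
  exact ⟨1 ⊗ₜ x, by rw [diskMap_tmul, hx, Pi.single_eq_same, one_smul]⟩

/-- By weak approximation, `V` is generated by the expansions at `p` of sections. -/
lemma diskMap_surjective : Function.Surjective D.diskMap := by
  intro v
  -- Up to the span of the expansions, `v` comes from an element `w` of `W`; a multiple of `w` by
  -- a function that is invertible at `p` extends to a section.
  obtain ⟨w, _, ⟨i, hi, rfl⟩, h⟩ := exists_one_tmul_add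
    ((LinearMap.range D.diskMap).map D.map) (fun x => by
      obtain ⟨z, rfl⟩ := D.puncturedEquiv.surjective x
      obtain ⟨⟨y, a⟩, h⟩ := IsLocalizedModule.surj (nonZeroDivisors (Disk p))
        (TensorProduct.mk (Disk p) (PuncturedDisk p) (Disk p ⊗[ℂ[X]] Und D.glued) 1) z
      refine ⟨a, nonZeroDivisors.coe_ne_zero a, D.diskMap y, ⟨y, rfl⟩, ?_⟩
      have h : (a : Disk p) • z = 1 ⊗ₜ y := h
      rw [map_diskMap, ← h, map_smul]) (D.map v)
  rw [← sub_eq_iff_eq_add, ← map_sub] at h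
  obtain ⟨s, -, hs, x, hx⟩ := D.exists_toW_eq_smul w
  have hu := isUnit_expand p (hs ⟨_, h⟩)
  have h0 : D.map (D.toV 0 x - algebraMap ℂ[X] (Disk p) s • (v - i)) = 0 := by
    rw [map_sub, map_toV, tau_zero_smul, hx, map_smul, h, TensorProduct.tmul_smul, algebraMap_smul,
      sub_self]
  have h1 : algebraMap ℂ[X] (Disk p) s • (v - i) ∈ LinearMap.range D.diskMap := by
    have hx' : D.toV 0 x ∈ LinearMap.range D.diskMap :=
      ⟨1 ⊗ₜ x, by rw [diskMap_tmul, one_smul]⟩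
    have := sub_mem hx' (mem_range_diskMap_of_map_eq_zero h0)
    rwa [sub_sub_cancel] at this
  have h2 := add_mem ((Submodule.smul_mem_iff_of_isUnit _ hu).1 h1) hi
  rwa [sub_add_cancel] at h2

/-- A section supported at `p` is determined by its expansion at `p`. -/
lemma eq_zero_of_coord_smul_eq_zero {x : Und D.glued} (hx : coord p • x = 0)
    (h : D.toV 0 x = 0) : x = 0 := by
  refine glued_ext ?_ fun n => ?_
  · have hp : coord p ∈ orbitMonoid p := by simpa using coord_pow_mem (p := p) 1
    rw [map_zero]
    refine eq_zero_of_mem_orbitMonoid hp ?_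
    rw [← map_smul, hx, map_zero]
  · rw [map_zero]
    rcases eq_or_ne n 0 with rfl | hn
    · exact h
    · have h1 := toV_smul n (coord p) x
      rw [hx, map_zero, tpow_smul_coord] at h1
      have hu : IsUnit (algebraMap ℂ[X] (Disk p) (coord (p + n))) := by
        refine isUnit_expand p ?_
        simpa [coord] using hn
      exact (hu.smul_eq_zero).1 h1.symm

lemma diskMap_injective : Function.Injective D.diskMap := by
  rw [injective_iff_map_eq_zero]
  -- The kernel is torsion, by comparison with the fibre at the punctured formal disk. It suffices
  -- to treat elements annihilated by `π`, which are expansions of sections supported at `p`.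
  have key : ∀ y, coord p • y = 0 → D.diskMap y = 0 → y = 0 := by
    intro y hy h
    obtain ⟨x, hx, rfl⟩ := exists_of_coord_smul_eq_zero hy
    rw [diskMap_tmul, one_smul] at h
    rw [eq_zero_of_coord_smul_eq_zero hx h, TensorProduct.tmul_zero]
  have key' : ∀ (k : ℕ) (y), algebraMap ℂ[X] (Disk p) (coord p ^ k) • y = 0 →
      D.diskMap y = 0 → y = 0 := by
    intro k
    induction k with
    | zero =>
      intro y hy _
      rwa [pow_zero, map_one, one_smul] at hy
    | succ k ih =>
      intro y hy h
      refine ih y (key _ ?_ ?_) h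
      · rwa [← algebraMap_smul (Disk p) (coord p), ← mul_smul, ← map_mul, ← pow_succ']
      · rw [map_smul, h, smul_zero]
  intro y hy
  have h1 : D.puncturedEquiv (1 ⊗ₜ y) = 0 := by rw [← map_diskMap, hy, map_zero]
  have h1 := (LinearEquiv.map_eq_zero_iff _).1 h1
  obtain ⟨a, ha⟩ := (IsLocalizedModule.eq_zero_iff (nonZeroDivisors (Disk p))
    (TensorProduct.mk (Disk p) (PuncturedDisk p) (Disk p ⊗[ℂ[X]] Und D.glued) 1)).1 h1
  obtain ⟨k, hk⟩ := exists_coord_pow_smul_mem (N := ⊥) (x := y)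
    (nonZeroDivisors.coe_ne_zero a) ((Submodule.mem_bot (Disk p)).2 ha)
  exact key' k y hk hy

variable (D) in
/-- The fibre at the formal disk of the glued module is `V`. -/
def diskEquiv : Disk p ⊗[ℂ[X]] Und D.glued ≃ₗ[Disk p] V :=
  LinearEquiv.ofBijective D.diskMap ⟨diskMap_injective, diskMap_surjective⟩

/-- A difference submodule of the glued module that generates its restrictions to the punctured
line and to the formal disk is everything. -/
lemma eq_top_of_generates (H : Submodule (DiffOp ℂ[X]) (Und D.glued))
    (hW : ∀ w, ∃ s ∈ orbitMonoid p, ∃ x ∈ H, D.toW x = s • w)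
    (hV : Submodule.span (Disk p) (D.toV 0 '' (H : Set (Und D.glued))) = ⊤) : H = ⊤ := by
  let Q : ModuleCat.{u} (DiffOp ℂ[X]) := ModuleCat.of (DiffOp ℂ[X]) (Und D.glued ⧸ H)
  let q : Und D.glued →ₗ[ℂ[X]] Und Q := undMap (M := D.glued) (N := Q) (ModuleCat.ofHom H.mkQ)
  have hq : ∀ {x}, q x = 0 ↔ x ∈ H := Submodule.Quotient.mk_eq_zero H
  have hspan : Submodule.span (Disk p)
      ((fun x => (1 : Disk p) ⊗ₜ[ℂ[X]] x) '' (H : Set (Und D.glued))) = ⊤ := by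
    refine Submodule.map_injective_of_injective (f := D.diskMap) diskMap_injective ?_
    rw [Submodule.map_span, Submodule.map_top, LinearMap.range_eq_top.2 diskMap_surjective, ← hV,
      Set.image_image]
    simp only [diskMap_tmul, one_smul]
  have hzero : ∀ y, TensorProduct.AlgebraTensorModule.lTensor (Disk p) (Disk p) q y = 0 := by
    intro y
    have hy : y ∈ Submodule.span (Disk p)
      ((fun x => (1 : Disk p) ⊗ₜ[ℂ[X]] x) '' (H : Set (Und D.glued))) := hspan ▸ trivial
    refine LinearMap.mem_ker.1 (Submodule.span_le.2 ?_ hy)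
    rintro _ ⟨x, hx, rfl⟩
    change (1 : Disk p) ⊗ₜ[ℂ[X]] (q x) = 0
    rw [hq.2 hx, TensorProduct.tmul_zero]
  refine Submodule.eq_top_iff'.2 fun x => hq.1 ?_
  refine eq_zero_of_orbit_torsion (p := p) (M := Q) ⊤ (fun y _ hy => ?_) trivial ?_
  · obtain ⟨x, rfl⟩ : ∃ x, q x = y := H.mkQ_surjective y
    exact eq_zero_of_one_tmul_eq_zero hy (hzero (1 ⊗ₜ x))
  · obtain ⟨s, hs, x', hx', h⟩ := hW (D.toW x)
    have h0 : D.toW (s • x - x') = 0 := by rw [map_sub, map_smul, h, sub_self]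
    obtain ⟨t, ht, h1⟩ := exists_smul_eq_zero_of_toW_eq_zero h0
    refine ⟨t * s, mul_mem ht hs, ?_⟩
    have h2 := congrArg q h1
    rwa [map_smul, map_sub, hq.2 hx', sub_zero, map_smul, ← mul_smul, map_zero] at h2

lemma exists_annihilator (x : Und D.glued) : ∃ d : DiffOp ℂ[X], d ≠ 0 ∧ d • x = 0 := by
  obtain ⟨d, hd, h⟩ := D.holonomic.2 (D.toW x)
  obtain ⟨s, hs, e, he⟩ := exists_coeffHom_mul_eq d
  have h0 : D.toW (e • x) = 0 := by
    rw [toW_smul, ← he, mul_smul]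
    exact (congrArg _ h).trans (smul_zero (A := Und W) _)
  obtain ⟨t, ht, h1⟩ := exists_smul_eq_zero_of_toW_eq_zero h0
  refine ⟨coeffHom ℂ[X] t * e, fun h2 => ?_, by rw [mul_smul]; exact h1⟩
  have h3 := congrArg (extendOp p) h2
  rw [map_mul, ← he, map_zero, extendOp_coeffHom, (isUnit_coeffHom ht).mul_right_eq_zero,
    (isUnit_coeffHom hs).mul_right_eq_zero] at h3
  exact hd h3

/-- The elements of `W` with a multiple that extends to a section in a given difference submodule
form a difference submodule. -/
lemma exists_toW_eq_smul_of_span (H : Submodule (DiffOp ℂ[X]) (Und D.glued)) {S : Set (Und W)}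
    (hS : Submodule.span (DiffOp (PuncturedLine p)) S = ⊤)
    (h : ∀ w ∈ S, ∃ s ∈ orbitMonoid p, ∃ x ∈ H, D.toW x = s • w) (w : Und W) :
    ∃ s ∈ orbitMonoid p, ∃ x ∈ H, D.toW x = s • w := by
  have hH : ∀ (f : ℂ[X]) {x}, x ∈ H → f • x ∈ H := fun f x hx => H.smul_mem (coeffHom ℂ[X] f) hx
  have hw : w ∈ Submodule.span (DiffOp (PuncturedLine p)) S := hS ▸ trivial
  induction hw using Submodule.span_induction with
  | mem w hw => exact h w hw
  | zero => exact ⟨1, one_mem _, 0, zero_mem _, by rw [smul_zero, map_zero]⟩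
  | add w w' _ _ hw hw' =>
    obtain ⟨s, hs, x, hx, e⟩ := hw
    obtain ⟨s', hs', x', hx', e'⟩ := hw'
    refine ⟨s * s', mul_mem hs hs', s' • x + s • x', add_mem (hH _ hx) (hH _ hx'), ?_⟩
    rw [map_add, map_smul, map_smul, e, e', smul_add, ← mul_smul, ← mul_smul, mul_comm s' s]
  | smul d w _ hw =>
    obtain ⟨s, hs, x, hx, e⟩ := hw
    obtain ⟨c, hc⟩ := isUnit_coeffHom hs
    obtain ⟨t, ht, d', h'⟩ := exists_coeffHom_mul_eq (d * ((c⁻¹ : (DiffOp (PuncturedLine p))ˣ) :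
      DiffOp (PuncturedLine p)))
    refine ⟨t, ht, d' • x, H.smul_mem _ hx, ?_⟩
    have e : D.toW x = (c : DiffOp (PuncturedLine p)) • w := by rw [e, hc]; rfl
    rw [toW_smul, ← h', e, ← mul_smul, mul_assoc, mul_assoc, Units.inv_mul, mul_one, mul_smul]
    rfl

/-- The glued module is holonomic: it is generated by lifts of generators of `W` together with
sections whose expansions at `p` generate `V`. -/
lemma glued_holonomic [Module.Finite (Disk p) V] : IsHolonomic ℂ[X] D.glued := by
  classical
  refine ⟨?_, exists_annihilator⟩
  obtain ⟨⟨hS⟩, -⟩ := D.holonomic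
  obtain ⟨S, hS⟩ : ∃ S : Finset (Und W),
    Submodule.span (DiffOp (PuncturedLine p)) (S : Set (Und W)) = ⊤ := hS
  have htop : Submodule.span (Disk p) (Set.range (D.toV 0)) = ⊤ := by
    rw [eq_top_iff]
    rintro v -
    obtain ⟨y, rfl⟩ := diskMap_surjective (D := D) v
    induction y using TensorProduct.induction_on with
    | zero => rw [map_zero]; exact zero_mem _
    | add x y hx hy => rw [map_add]; exact add_mem hx hy
    | tmul a x =>
      rw [diskMap_tmul]
      exact Submodule.smul_mem _ _ (Submodule.subset_span ⟨x, rfl⟩)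
  obtain ⟨T, hT, hT'⟩ := (Submodule.fg_span_iff_fg_span_finset_subset (R := Disk p)
    (Set.range (D.toV 0))).1 (htop ▸ Module.Finite.fg_top)
  choose t ht using fun v : T => hT v.2
  choose s hs hs' x hx using D.exists_toW_eq_smul
  let F : Finset (Und D.glued) := S.image x ∪ Finset.univ.image t
  refine ⟨⟨F, ?_⟩⟩
  change Submodule.span (DiffOp ℂ[X]) (F : Set (Und D.glued)) = ⊤
  refine eq_top_of_generates _ ?_ ?_
  · refine exists_toW_eq_smul_of_span _ hS fun w hw => ?_
    refine ⟨s w, hs w, x w, Submodule.subset_span ?_, hx w⟩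
    simp only [F, Finset.coe_union, Finset.coe_image]
    exact Or.inl ⟨w, hw, rfl⟩
  · rw [eq_top_iff, ← htop, hT']
    refine Submodule.span_mono fun v hv => ?_
    exact ⟨t ⟨v, hv⟩, Submodule.subset_span (by simp [F]), ht ⟨v, hv⟩⟩

end Gluing

namespace Gluing

variable {p : ℂ} {W : ModuleCat.{u} (DiffOp (PuncturedLine p))} {V : Type u}
  [AddCommGroup V] [Module (Disk p) V] [Module ℂ[X] V] [IsScalarTower ℂ[X] (Disk p) V]
  {D : Gluing p W V}

lemma toV_mem_of_span {N : Submodule (Disk p) V} {S : Set (Und D.glued)} {n : ℤ}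
    (h : ∀ x ∈ S, D.toV n x ∈ N) {x : Und D.glued} (hx : x ∈ Submodule.span ℂ[X] S) :
    D.toV n x ∈ N := by
  induction hx using Submodule.span_induction with
  | mem x hx => exact h x hx
  | zero => rw [map_zero]; exact zero_mem _
  | add x y _ _ hx hy => rw [map_add]; exact add_mem hx hy
  | smul f x _ hx => rw [toV_smul]; exact N.smul_mem _ hx

/-- The lattice at an end of the glued module is the corresponding submodule of `V`: it is
contained in it, both have the same image in the fibre of `W`, and there is no torsion. -/
lemma map_endLattice_glued [Module.Finite (Disk p) V] {l : Filter ℤ} (hl : IsEnd l)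
    {N : Submodule (Disk p) V} (hN : N.map D.map = endLattice p (PuncturedDisk p) l W)
    (h0 : ∀ v ∈ N, D.map v = 0 → v = 0) (hev : ∀ x, ∀ᶠ n in l, D.toV n x ∈ N) :
    (endLattice p (Disk p) l D.glued).map D.diskMap = N := by
  have := hl.neBot
  have hG : IsHolonomic ℂ[X] D.glued := glued_holonomic
  have hle : (endLattice p (Disk p) l D.glued).map D.diskMap ≤ N := by
    obtain ⟨L, hL, -⟩ := exists_coherent hG
    obtain ⟨S, hS⟩ := hL.1
    obtain ⟨n, h1, h2⟩ := ((endLattice_eq (p := p) (E := Disk p) hl hL).and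
      ((eventually_all_finset S).2 fun x _ => hev x)).exists
    rw [← h1, formalFibre, Submodule.map_span, Submodule.span_le]
    rintro _ ⟨_, ⟨_, ⟨x, hx, rfl⟩, rfl⟩, rfl⟩
    change D.diskMap (1 ⊗ₜ[ℂ[X]] (tau ℂ[X] n • x)) ∈ N
    rw [diskMap_tmul, one_smul, toV_tau, zero_add]
    exact toV_mem_of_span h2 (hS ▸ hx)
  refine le_antisymm hle fun v hv => ?_
  have h1 : D.map v ∈ endLattice p (PuncturedDisk p) l W := hN ▸ ⟨v, hv, rfl⟩
  have h2 := fibreMap_mem D.holonomic (baseChange_holonomic p hG) D.lineIso.inv hl h1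
  rw [← map_endLattice hG hl] at h2
  obtain ⟨_, ⟨y, hy, rfl⟩, h2⟩ := h2
  have h3 : fibreMap p (PuncturedDisk p) D.lineIso.hom
      (fibreMap p (PuncturedDisk p) D.lineIso.inv (D.map v)) = D.map v := by
    refine (LinearMap.congr_fun (TensorProduct.AlgebraTensorModule.lTensor_comp
      (A := Disk p) (M := PuncturedDisk p) (undMap D.lineIso.hom)
      (undMap D.lineIso.inv)) (D.map v)).symm.trans ?_
    have : undMap D.lineIso.hom ∘ₗ undMap D.lineIso.inv = LinearMap.id :=
      LinearMap.ext fun w => D.lineIso.inv_hom_id_apply w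
    rw [this, TensorProduct.AlgebraTensorModule.lTensor_id, LinearMap.id_apply]
  have h4 : D.map (D.diskMap y) = D.map v := by
    rw [map_diskMap, puncturedEquiv_apply, ← h3, ← h2]
    rfl
  refine ⟨y, hy, sub_eq_zero.1 (h0 _ (sub_mem (hle ⟨y, hy, rfl⟩) hv) ?_)⟩
  rw [map_sub, h4, sub_self]

/-! ### Morphisms to a glued module -/

variable {M : ModuleCat.{u} (DiffOp ℂ[X])}

variable (D) in
/-- The morphism to the glued module given by compatible maps to `W` and to `V`. -/
def lift (f : Und M →ₗ[ℂ[X]] Und W) (g : Und M →ₗ[ℂ[X]] V)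
    (hτ : ∀ (n : ℤ) m, f (tau ℂ[X] n • m) = tau (PuncturedLine p) n • f m)
    (hfg : ∀ m, D.map (g m) = (1 : PuncturedDisk p) ⊗ₜ[ℂ[X]] f m)
    (hl : ∀ m, ∀ᶠ n in atTop, g (tau ℂ[X] n • m) ∈ D.left)
    (hr : ∀ m, ∀ᶠ n in atBot, g (tau ℂ[X] n • m) ∈ D.right) : M ⟶ D.glued :=
  let F : Und M →+ Und D.glued :=
    { toFun := fun m => (⟨(f m, fun n => g (tau ℂ[X] n • m)),
        fun n => (hfg _).trans (by rw [hτ]), hl m, hr m⟩ : D.families)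
      map_zero' := glued_ext (map_zero f) fun n => by
        change g (tau ℂ[X] n • (0 : Und M)) = 0
        rw [smul_zero, map_zero]
      map_add' := fun x y => glued_ext (map_add f x y) fun n => by
        change g (tau ℂ[X] n • (x + y)) = g (tau ℂ[X] n • x) + g (tau ℂ[X] n • y)
        rw [smul_add, map_add] }
  homOfEquivariant F
    (fun a x => glued_ext ((map_smul f a x).trans (map_smul D.toW a (F x)).symm) fun n => by
      rw [toV_smul]
      change g (tau ℂ[X] n • (a • x)) = algebraMap ℂ[X] (Disk p) _ • g (tau ℂ[X] n • x)
      rw [tau_smul_poly, map_smul, algebraMap_smul])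
    (fun k x => glued_ext ((hτ k x).trans (toW_tau k (F x)).symm) fun n => by
      rw [toV_tau]
      change g (tau ℂ[X] n • (tau ℂ[X] k • x)) = g (tau ℂ[X] (n + k) • x)
      rw [tau_tau])

/-- A morphism to the glued module that induces isomorphisms on the restrictions to the punctured
line and to the formal disk is bijective. -/
lemma bijective_of_restrictions (η : M ⟶ D.glued)
    (a : PuncturedLine p ⊗[ℂ[X]] Und M ≃ₗ[ℂ[X]] Und W)
    (ha : ∀ m, a (1 ⊗ₜ m) = D.toW (undMap η m))
    (b : Disk p ⊗[ℂ[X]] Und M ≃ₗ[Disk p] V)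
    (hb : ∀ m, b (1 ⊗ₜ m) = D.toV 0 (undMap η m)) : Function.Bijective (undMap η) := by
  constructor
  · rw [injective_iff_map_eq_zero]
    intro m hm
    refine eq_zero_of_orbit_torsion (p := p) (M := M) (LinearMap.ker η.hom)
      (fun h hh hp => ?_) hm ?_
    · refine eq_zero_of_one_tmul_eq_zero hp (b.injective ?_)
      have hh : undMap η h = 0 := hh
      rw [hb, hh, map_zero, map_zero]
    · have h1 : (1 : PuncturedLine p) ⊗ₜ[ℂ[X]] m = 0 :=
        a.injective (by rw [ha, hm, map_zero, map_zero])
      obtain ⟨s, hs⟩ := (IsLocalizedModule.eq_zero_iff (orbitMonoid p)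
        (TensorProduct.mk ℂ[X] (PuncturedLine p) (Und M) 1)).1 h1
      exact ⟨s, s.2, hs⟩
  · have := eq_top_of_generates (D := D) (LinearMap.range η.hom) (fun w => ?_) ?_
    · exact (LinearMap.range_eq_top (f := η.hom)).1 this
    · obtain ⟨y, rfl⟩ := a.surjective w
      obtain ⟨s, hs', m, h⟩ := exists_smul_eq_mk p y
      exact ⟨s, hs', undMap η m, ⟨m, rfl⟩, by rw [← map_smul, h, ha]⟩
    · rw [eq_top_iff]
      rintro v -
      obtain ⟨y, rfl⟩ := b.surjective v
      induction y using TensorProduct.induction_on with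
      | zero => rw [map_zero]; exact zero_mem _
      | add x y hx hy => rw [map_add]; exact add_mem hx hy
      | tmul c m =>
        rw [← mul_one c, ← smul_eq_mul, ← TensorProduct.smul_tmul', map_smul, hb]
        exact Submodule.smul_mem _ _ (Submodule.subset_span ⟨_, ⟨m, rfl⟩, rfl⟩)

end Gluing

/-! ### The fibre product of categories -/

/-- Functions on the line act on a module over the functions on the formal disk through their Taylor
expansions. -/
instance instPolynomialModuleLR {p : ℂ} (V : LRModule.{u} (Disk p)) : Module ℂ[X] V.carrier :=
  Module.compHom V.carrier (algebraMap ℂ[X] (Disk p))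

instance {p : ℂ} (V : LRModule.{u} (Disk p)) : IsScalarTower ℂ[X] (Disk p) V.carrier where
  smul_assoc f a v := by
    rw [Algebra.smul_def, mul_smul]
    rfl

lemma IsFreeCotorsion.eq_zero {p : ℂ} {V : Type u} [AddCommGroup V] [Module (Disk p) V]
    {N : Submodule (Disk p) V} (hN : IsFreeCotorsion N) {v : V} (hv : v ∈ N)
    (h : (1 : PuncturedDisk p) ⊗ₜ[Disk p] v = 0) : v = 0 := by
  have := hN.free
  obtain ⟨a, ha⟩ := (IsLocalizedModule.eq_zero_iff (nonZeroDivisors (Disk p))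
    (TensorProduct.mk (Disk p) (PuncturedDisk p) V 1)).1 h
  have h1 : (a : Disk p) • (⟨v, hv⟩ : N) = 0 := Subtype.ext ha
  exact congrArg Subtype.val ((smul_eq_zero.1 h1).resolve_left (nonZeroDivisors.coe_ne_zero a))

/-- An isomorphism of modules with left and right submodules, as a linear equivalence. -/
def LRModule.equivOfIso {O : Type} [CommRing O] {M N : LRModule.{u} O} (e : M ≅ N) :
    M.carrier ≃ₗ[O] N.carrier :=
  LinearEquiv.ofLinearMap e.hom.lin e.inv.lin
    (by rw [← LRModule.comp_lin, e.inv_hom_id]; rfl)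
    (by rw [← LRModule.comp_lin, e.hom_inv_id]; rfl)

lemma LRModule.map_left_of_iso {O : Type} [CommRing O] {M N : LRModule.{u} O} (e : M ≅ N) :
    M.left.map e.hom.lin = N.left := by
  refine le_antisymm ?_ fun y hy => ⟨e.inv.lin y, e.inv.map_left y hy,
    (LRModule.equivOfIso e).apply_symm_apply y⟩
  rintro _ ⟨x, hx, rfl⟩
  exact e.hom.map_left x hx

lemma LRModule.map_right_of_iso {O : Type} [CommRing O] {M N : LRModule.{u} O} (e : M ≅ N) :
    M.right.map e.hom.lin = N.right := by
  refine le_antisymm ?_ fun y hy => ⟨e.inv.lin y, e.inv.map_right y hy,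
    (LRModule.equivOfIso e).apply_symm_apply y⟩
  rintro _ ⟨x, hx, rfl⟩
  exact e.hom.map_right x hx

section Equivalence

variable (p : ℂ)

/-- The category of triples `(M_{U_p}, M_{𝔸¹*}, ≅)`. -/
abbrev Triples : Type (u + 1) :=
  CategoricalPullback (diskToPuncturedDisk.{u} p) (puncturedLineToPuncturedDisk.{u} p)

/-- The functor from difference modules on the line to triples. -/
abbrev toTriples : Hol.{u} ℂ[X] ⥤ Triples.{u} p :=
  (CategoricalPullback.CatCommSqOver.toFunctorToCategoricalPullback
    (diskToPuncturedDisk.{u} p) (puncturedLineToPuncturedDisk.{u} p) (Hol.{u} ℂ[X])).obj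
    (restrictionSquare.{u} p)

variable {p} (T : Triples.{u} p)

/-- The isomorphism of modules with left and right submodules contained in a triple. -/
def tripleIso : puncture p T.fst.obj ≅ restrict p (PuncturedDisk p) T.snd.obj :=
  (ObjectProperty.ι (IsPuncturedDiskModule.{u} p)).mapIso T.iso

/-- The identification of `ℂ⸨π⸩ ⊗ V` with the fibre of `W` contained in a triple. -/
def tripleEquiv : PuncturedDisk p ⊗[Disk p] T.fst.obj.carrier ≃ₗ[Disk p]
    PuncturedDisk p ⊗[ℂ[X]] Und T.snd.obj :=
  LRModule.equivOfIso (tripleIso T)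

/-- The gluing datum of a triple. -/
def gluingOfTriple : Gluing p T.snd.obj T.fst.obj.carrier where
  holonomic := T.snd.property
  map := (tripleEquiv T).toLinearMap ∘ₗ
    TensorProduct.mk (Disk p) (PuncturedDisk p) T.fst.obj.carrier 1
  isLocalizedModule := IsLocalizedModule.of_linearEquiv _ _ _
  left := T.fst.obj.left
  right := T.fst.obj.right
  map_left := by
    rw [Submodule.map_comp]
    exact LRModule.map_left_of_iso (tripleIso T)
  map_right := by
    rw [Submodule.map_comp]
    exact LRModule.map_right_of_iso (tripleIso T)
  eq_zero_left v hv h := T.fst.property.left.eq_zero hv ((LinearEquiv.map_eq_zero_iff _).1 h)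
  eq_zero_right v hv h := T.fst.property.right.eq_zero hv ((LinearEquiv.map_eq_zero_iff _).1 h)

/-- The holonomic difference module glued from a triple. -/
def gluedHol : Hol.{u} ℂ[X] :=
  ⟨(gluingOfTriple T).glued,
    have := T.fst.property.finite
    Gluing.glued_holonomic⟩

variable {T} {M : Hol.{u} ℂ[X]}

/-- The component on the formal disk of a morphism of triples. -/
def diskComponent (h : (toTriples p).obj M ⟶ T) :
    Disk p ⊗[ℂ[X]] Und M.obj →ₗ[Disk p] T.fst.obj.carrier := h.fst.hom.lin

/-- The component on the punctured line of a morphism of triples. -/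
def lineComponent (h : (toTriples p).obj M ⟶ T) :
    baseChange (PuncturedLine p) M.obj ⟶ T.snd.obj := h.snd.hom

lemma tripleEquiv_diskComponent (h : (toTriples p).obj M ⟶ T) (m : Und M.obj) :
    tripleEquiv T ((1 : PuncturedDisk p) ⊗ₜ[Disk p] diskComponent h (1 ⊗ₜ[ℂ[X]] m)) =
      (1 : PuncturedDisk p) ⊗ₜ[ℂ[X]]
        (undMap (lineComponent h) (toBaseChange (PuncturedLine p) M.obj m)) := by
  have h1 : (tripleEquiv T).toLinearMap ∘ₗ
      TensorProduct.AlgebraTensorModule.lTensor (Disk p) (PuncturedDisk p) (diskComponent h) =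
      fibreMap p (PuncturedDisk p) (lineComponent h) ∘ₗ (squareEquiv p M.obj).toLinearMap :=
    congrArg (fun f => f.hom.lin) h.w
  refine (LinearMap.congr_fun h1 (1 ⊗ₜ (1 ⊗ₜ m))).trans ?_
  rw [LinearMap.comp_apply, LinearEquiv.coe_coe, squareEquiv_tmul, one_smul]
  rfl

/-- The expansion at `p` of an element of a difference module, mapped by a morphism of triples. -/
def expandThrough (h : (toTriples p).obj M ⟶ T) : Und M.obj →ₗ[ℂ[X]] T.fst.obj.carrier where
  toFun m := diskComponent h (1 ⊗ₜ m)
  map_add' x y := by rw [TensorProduct.tmul_add, map_add]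
  map_smul' f x := by
    rw [TensorProduct.tmul_smul, ← algebraMap_smul (Disk p) f ((1 : Disk p) ⊗ₜ[ℂ[X]] x), map_smul,
      algebraMap_smul, RingHom.id_apply]

/-- The morphism to the glued module that corresponds to a morphism of triples. -/
def liftTriple (h : (toTriples p).obj M ⟶ T) : M.obj ⟶ (gluingOfTriple T).glued :=
  (gluingOfTriple T).lift (undMap (lineComponent h) ∘ₗ toBaseChange (PuncturedLine p) M.obj)
    (expandThrough h)
    (fun n m => by
      rw [LinearMap.comp_apply, ← tau_toBaseChange]
      exact map_smul (lineComponent h).hom (tau (PuncturedLine p) n) _)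
    (tripleEquiv_diskComponent h)
    (fun m => by
      filter_upwards [eventually_tmul_mem_endLattice (p := p) (E := Disk p) M.property
        (Or.inl rfl) m] with n hn using h.fst.hom.map_left _ hn)
    (fun m => by
      filter_upwards [eventually_tmul_mem_endLattice (p := p) (E := Disk p) M.property
        (Or.inr rfl) m] with n hn using h.fst.hom.map_right _ hn)

lemma toW_liftTriple (h : (toTriples p).obj M ⟶ T) (m : Und M.obj) :
    (gluingOfTriple T).toW (undMap (liftTriple h) m) =
      undMap (lineComponent h) (toBaseChange (PuncturedLine p) M.obj m) := rfl

lemma toV_liftTriple (h : (toTriples p).obj M ⟶ T) (n : ℤ) (m : Und M.obj) :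
    (gluingOfTriple T).toV n (undMap (liftTriple h) m) =
      diskComponent h (1 ⊗ₜ (tau ℂ[X] n • m)) := rfl

variable (p M) in
/-- A difference module is recovered from its triple by gluing. -/
instance isIso_liftTriple_id : IsIso (liftTriple (𝟙 ((toTriples p).obj M))) := by
  rw [ConcreteCategory.isIso_iff_bijective]
  exact Gluing.bijective_of_restrictions (D := gluingOfTriple ((toTriples p).obj M)) _
    undBaseChange.symm (fun m => rfl) (LinearEquiv.refl (Disk p) (Disk p ⊗[ℂ[X]] Und M.obj))
    fun m => by
      rw [toV_liftTriple (𝟙 ((toTriples p).obj M)), tau_zero_smul]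
      rfl

/-- A morphism of triples out of the triple of a difference module is determined by the
corresponding morphism to the glued module. -/
lemma liftTriple_injective {h h' : (toTriples p).obj M ⟶ T} (e : liftTriple h = liftTriple h') :
    h = h' := by
  have hV : diskComponent h = diskComponent h' := by
    refine LinearMap.ext fun y => ?_
    induction y using TensorProduct.induction_on with
    | zero => rw [map_zero, map_zero]
    | add x y hx hy => rw [map_add, map_add, hx, hy]
    | tmul c m =>
      have h1 := toV_liftTriple h 0 m
      rw [e, toV_liftTriple, tau_zero_smul] at h1
      rw [← mul_one c, ← smul_eq_mul, ← TensorProduct.smul_tmul', map_smul, map_smul, h1]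
  have hW : lineComponent h = lineComponent h' := by
    refine ModuleCat.hom_ext (LinearMap.ext
      fun (y : Und (baseChange (PuncturedLine p) M.obj)) => ?_)
    change undMap (lineComponent h) y = undMap (lineComponent h') y
    obtain ⟨s, hs, m, h1⟩ := exists_smul_eq_mk p (undBaseChange y)
    refine (smul_bijective_of_mem_orbitMonoid hs).1 ?_
    have h2 : s • y = toBaseChange (PuncturedLine p) M.obj m :=
      undBaseChange.injective ((map_smul undBaseChange s y).trans h1)
    change s • undMap (lineComponent h) y = s • undMap (lineComponent h') y
    have h3 := toW_liftTriple h m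
    rw [e, toW_liftTriple] at h3
    rw [← map_smul, ← map_smul, h2, h3]
  refine CategoricalPullback.hom_ext ?_ ?_
  · ext : 1
    exact LRModule.hom_ext hV
  · ext : 1
    exact hW

lemma liftTriple_map {M N : Hol.{u} ℂ[X]} (f : M ⟶ N) :
    liftTriple ((toTriples p).map f) = f.hom ≫ liftTriple (𝟙 ((toTriples p).obj N)) := by
  refine ModuleCat.hom_ext (LinearMap.ext fun m => Gluing.glued_ext rfl fun n => ?_)
  change (1 : Disk p) ⊗ₜ[ℂ[X]] (undMap f.hom (tau ℂ[X] n • m)) =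
    (1 : Disk p) ⊗ₜ[ℂ[X]] (tau ℂ[X] n • undMap f.hom m)
  congr 1
  exact map_smul f.hom.hom (tau ℂ[X] n) m

instance : (toTriples.{u} p).Full where
  map_surjective {M N} h := by
    refine ⟨ObjectProperty.homMk (liftTriple h ≫ inv (liftTriple (𝟙 ((toTriples p).obj N)))),
      liftTriple_injective ?_⟩
    rw [liftTriple_map]
    exact (Category.assoc _ _ _).trans ((congrArg _ (IsIso.inv_hom_id _)).trans
      (Category.comp_id _))

instance : (toTriples.{u} p).Faithful where
  map_injective {M N f g} h := by
    ext : 1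
    rw [← cancel_mono (liftTriple (𝟙 ((toTriples p).obj N))), ← liftTriple_map, ← liftTriple_map, h]

variable (T)

/-- The fibre at the formal disk of the glued module, with its left and right submodules. -/
def diskIso : restrict p (Disk p) (gluedHol T).obj ≅ T.fst.obj :=
  have := T.fst.property.finite
  LRModule.isoOfEquiv (gluingOfTriple T).diskEquiv
    (Gluing.map_endLattice_glued (Or.inl rfl) (gluingOfTriple T).map_left
      (gluingOfTriple T).eq_zero_left Gluing.eventually_toV_left)
    (Gluing.map_endLattice_glued (Or.inr rfl) (gluingOfTriple T).map_right
      (gluingOfTriple T).eq_zero_right Gluing.eventually_toV_right)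

lemma tripleEquiv_lTensor_diskMap :
    (tripleEquiv T).toLinearMap ∘ₗ TensorProduct.AlgebraTensorModule.lTensor (Disk p)
      (PuncturedDisk p) (gluingOfTriple T).diskMap =
    (gluingOfTriple T).puncturedEquiv.toLinearMap := by
  refine IsLocalizedModule.ext (nonZeroDivisors (Disk p))
    (TensorProduct.mk (Disk p) (PuncturedDisk p)
      (Disk p ⊗[ℂ[X]] Und (gluingOfTriple T).glued) 1) (fun a => ?_)
    (LinearMap.ext fun y => Gluing.map_diskMap y)
  have := (gluingOfTriple T).isLocalizedModule
  exact IsLocalizedModule.map_units (gluingOfTriple T).map a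

/-- The triple of the module glued from a triple. -/
def toTriplesGluedIso : (toTriples p).obj (gluedHol T) ≅ T :=
  CategoricalPullback.mkIso (ObjectProperty.isoMk _ (diskIso T))
    (ObjectProperty.isoMk _ (gluingOfTriple T).lineIso) (by
      ext : 1
      exact LRModule.hom_ext (tripleEquiv_lTensor_diskMap T))

instance : (toTriples.{u} p).EssSurj where
  mem_essImage T := ⟨gluedHol T, ⟨toTriplesGluedIso T⟩⟩

variable (p) in
lemma isEquivalence_toTriples : (toTriples.{u} p).IsEquivalence where

end Equivalence

end DifferenceModules

end

/-- The square of restrictions of holonomic difference modules is a fibre product of categories: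
the induced functor from `Hol(𝔸¹)` to the category of triples `(M_{U_p}, M_{𝔸¹*}, ≅)` is an
equivalence. -/
theorem theorem1 (p : ℂ) :
    ((CategoricalPullback.CatCommSqOver.toFunctorToCategoricalPullback
        (DifferenceModules.diskToPuncturedDisk.{u} p)
        (DifferenceModules.puncturedLineToPuncturedDisk.{u} p)
        (DifferenceModules.Hol.{u} ℂ[X])).obj
      (DifferenceModules.restrictionSquare.{u} p)).IsEquivalence := by
  have := DifferenceModules.isEquivalence_toTriples.{u} p
  exact this
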